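/- Let $1\le d\le N$ be integers. The twisted polygonal sphere $\bar S^{N-1,d-1}_{\mathbb R}$ is the noncommutative manifold whose algebra $C(\bar S^{N-1,d-1}_{\mathbb R})$ is the universal unital $C^*$-algebra generated by self-adjoint elements $x_1,\ldots,x_N$ subject to the relations $\sum_i x_i^2=1$, $x_ix_j=-x_jx_i$ for $i\neq j$, and $x_{i_0}x_{i_1}\cdots x_{i_d}=0$ for $i_0,\ldots,i_d$ distinct. A closed quantum subgroup $G\subset O_N^+$ is a compact quantum group in the sense of Woronowicz, given by a unital $C^*$-algebra $C(G)$ generated by the self-adjoint entries $u_{ij}$ of an orthogonal $N\times N$ matrix $u$, with comultiplication $\Delta(u_{ij})=\sum_k u_{ik}\otimes u_{kj}$ defined on $C(G)$ (with values in the minimal tensor product), and with counit $\varepsilon(u_{ij})=\delta_{ij}$ and antipode $S(u_{ij})=u_{ji}$ defined on the dense $*$-algebra generated by the $u_{ij}$. It acts affinely on a noncommutative manifold $X$ with coordinates $x_1,\ldots,x_N$ if there is a morphism of $C^*$-algebras $C(X)\to C(G)\otimes C(X)$ mapping $x_i\mapsto\sum_j u_{ij}\otimes x_j$. The quantum isometry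 group $G^+(X)$ is the largest closed quantum subgroup of $O_N^+$ acting affinely on $X$: it acts affinely on $X$, and for any closed quantum subgroup $G\subset O_N^+$ acting affinely on $X$ there is a morphism $C(G^+(X))\to C(G)$ mapping $u_{ij}\mapsto u_{ij}$. **Theorem 3.5.** The quantum isometry group of $\bar S^{N-1,d-1}_{\mathbb R}$ is as follows: 1. At $d=1$ (and any $N\geq1$) it is the free hyperoctahedral group $H_N^+\subset O_N^+$, defined by the relations $ab=0$ for any two different entries $a,b$ of $u$ on the same row or on the same column of $u$. 2. At $d=2$, with $N\geq3$, it is the hyperoctahedral group $H_N\subset O_N$ of signed permutation matrices, with $C(H_N)$ being the algebra of complex functions on $H_N$ and $u_{ij}(g)=g_{ij}$. 3. At $d=N$ (and any $N\geq1$) it is the twisted orthogonal group $\bar O_N\subset O_N^+$, defined by the relations $ab=-ba$ for any two different entries $a,b$ of $u$ on the same row or on the same column of $u$, and $ab=ba$ for any other two entries $a,b$. Here $C(H_N^+)$ and $C(\bar O_N)$ are the universal unital $C^*$-algebras generated by the self-adjoint entries of an orthogonal $N\times N$ matrix $u$ satisfying the relations in question. -/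

import Mathlib

open scoped TensorProduct

universe u v

noncomputable section

namespace QIso

/-! ### C*-seminorms and their completions -/

/-- A C*-seminorm on a complex unital *-algebra. -/
structure CStarSeminorm (F : Type u) [Ring F] [StarRing F] [Algebra ℂ F] extends
    Seminorm ℂ F where
  mul_le' : ∀ a b : F, toFun (a * b) ≤ toFun a * toFun b
  star_mul_self' : ∀ a : F, toFun (star a * a) = toFun a * toFun a

namespace CStarSeminorm

variable {F : Type u} [Ring F] [StarRing F] [Algebra ℂ F]

instance : CoeFun (CStarSeminorm F) (fun _ => F → ℝ) := ⟨fun p => p.toSeminorm⟩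

theorem mul_le (p : CStarSeminorm F) (a b : F) : p (a * b) ≤ p a * p b := p.mul_le' a b

theorem star_mul_self (p : CStarSeminorm F) (a : F) : p (star a * a) = p a * p a :=
  p.star_mul_self' a

theorem nonneg (p : CStarSeminorm F) (a : F) : 0 ≤ p a := apply_nonneg p.toSeminorm a

theorem le_star (p : CStarSeminorm F) (a : F) : p a ≤ p (star a) := by
  have h := p.mul_le (star a) a
  rw [p.star_mul_self] at h
  rcases (p.nonneg a).eq_or_lt with h0 | h0
  · rw [← h0]; exact p.nonneg _
  · exact le_of_mul_le_mul_right h h0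

theorem star_eq (p : CStarSeminorm F) (a : F) : p (star a) = p a :=
  le_antisymm (by simpa using p.le_star (star a)) (p.le_star a)

/-- The *-algebra `F`, regarded as a seminormed ring through `p`. -/
def Pre (_p : CStarSeminorm F) : Type u := F

instance (p : CStarSeminorm F) : Ring p.Pre := inferInstanceAs (Ring F)
instance (p : CStarSeminorm F) : StarRing p.Pre := inferInstanceAs (StarRing F)
instance (p : CStarSeminorm F) : Algebra ℂ p.Pre := inferInstanceAs (Algebra ℂ F)
instance [StarModule ℂ F] (p : CStarSeminorm F) : StarModule ℂ p.Pre :=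
  inferInstanceAs (StarModule ℂ F)

/-- The seminorm `p` on `p.Pre`. -/
def ringSeminorm (p : CStarSeminorm F) : RingSeminorm p.Pre where
  __ := p.toSeminorm.toAddGroupSeminorm
  mul_le' := p.mul_le'

instance (p : CStarSeminorm F) : SeminormedRing p.Pre := p.ringSeminorm.toSeminormedRing

theorem norm_pre (p : CStarSeminorm F) (a : p.Pre) : ‖a‖ = p a := rfl

instance (p : CStarSeminorm F) : NormedAlgebra ℂ p.Pre where
  norm_smul_le c a := le_of_eq (map_smul_eq_mul p.toSeminorm c a)

instance (p : CStarSeminorm F) : NormedStarGroup p.Pre where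
  norm_star_le a := le_of_eq (p.star_eq a)

/-- The C*-algebra obtained from `F` by dividing by the kernel of `p` and completing. -/
def Completed (p : CStarSeminorm F) : Type u := UniformSpace.Completion p.Pre

instance (p : CStarSeminorm F) : NormedRing p.Completed :=
  inferInstanceAs (NormedRing (UniformSpace.Completion p.Pre))

instance (p : CStarSeminorm F) : NormedAlgebra ℂ p.Completed where
  __ := (inferInstance : Algebra ℂ (UniformSpace.Completion p.Pre))
  norm_smul_le := norm_smul_le (α := ℂ) (β := UniformSpace.Completion p.Pre)

instance (p : CStarSeminorm F) : CompleteSpace p.Completed :=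
  inferInstanceAs (CompleteSpace (UniformSpace.Completion p.Pre))

/-- The canonical map of `F` to the completion. -/
def toCompleted (p : CStarSeminorm F) (a : F) : p.Completed :=
  UniformSpace.Completion.coe' (α := p.Pre) (show p.Pre from a)

theorem uniformContinuous_star (p : CStarSeminorm F) :
    UniformContinuous (star : p.Pre → p.Pre) := star_isometry.uniformContinuous

instance (p : CStarSeminorm F) : Star p.Completed where
  star := UniformSpace.Completion.map (star : p.Pre → p.Pre)

theorem continuous_star (p : CStarSeminorm F) :
    Continuous (star : p.Completed → p.Completed) :=
  UniformSpace.Completion.continuous_map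

theorem star_toCompleted (p : CStarSeminorm F) (a : F) :
    star (p.toCompleted a) = p.toCompleted (star a) := by
  have h := @UniformSpace.Completion.map_coe p.Pre _ p.Pre _ star p.uniformContinuous_star a
  exact h

theorem denseRange_toCompleted (p : CStarSeminorm F) : DenseRange p.toCompleted :=
  UniformSpace.Completion.denseRange_coe (α := p.Pre)

theorem norm_toCompleted (p : CStarSeminorm F) (a : F) : ‖p.toCompleted a‖ = p a :=
  UniformSpace.Completion.norm_coe (E := p.Pre) a

theorem toCompleted_mul (p : CStarSeminorm F) (a b : F) :
    p.toCompleted (a * b) = p.toCompleted a * p.toCompleted b :=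
  UniformSpace.Completion.coe_mul (α := p.Pre) a b

theorem toCompleted_add (p : CStarSeminorm F) (a b : F) :
    p.toCompleted (a + b) = p.toCompleted a + p.toCompleted b :=
  UniformSpace.Completion.coe_add (α := p.Pre) a b

theorem toCompleted_smul (p : CStarSeminorm F) (c : ℂ) (a : F) :
    p.toCompleted (c • a) = c • p.toCompleted a :=
  UniformSpace.Completion.coe_smul (X := p.Pre) c a

instance (p : CStarSeminorm F) : StarRing p.Completed where
  star_involutive a := by
    refine p.denseRange_toCompleted.induction_on a
      (isClosed_eq (p.continuous_star.comp p.continuous_star) continuous_id) fun a => ?_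
    simp [star_toCompleted]
  star_mul a b := by
    have hs := p.continuous_star
    refine p.denseRange_toCompleted.induction_on₂
      (isClosed_eq (by fun_prop) (by fun_prop)) (fun a b => ?_) a b
    simp [star_toCompleted, ← toCompleted_mul]
  star_add a b := by
    have hs := p.continuous_star
    refine p.denseRange_toCompleted.induction_on₂
      (isClosed_eq (by fun_prop) (by fun_prop)) (fun a b => ?_) a b
    simp [star_toCompleted, ← toCompleted_add]

theorem star_smul' [StarModule ℂ F] (p : CStarSeminorm F) (c : ℂ) (a : p.Completed) :
    star (c • a) = star c • star a := by
  have hs := p.continuous_star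
  refine p.denseRange_toCompleted.induction_on a
    (isClosed_eq (hs.comp (continuous_const_smul c)) ((continuous_const_smul (star c)).comp hs))
    fun a => ?_
  rw [← toCompleted_smul, star_toCompleted, star_smul, toCompleted_smul, star_toCompleted]

theorem norm_mul_self_le' (p : CStarSeminorm F) (a : p.Completed) : ‖a‖ * ‖a‖ ≤ ‖star a * a‖ := by
  have hs := p.continuous_star
  refine p.denseRange_toCompleted.induction_on a
    (isClosed_le (continuous_norm.mul continuous_norm) (hs.mul continuous_id).norm) fun a => ?_
  rw [star_toCompleted, ← toCompleted_mul, norm_toCompleted, norm_toCompleted, star_mul_self]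

instance [StarModule ℂ F] (p : CStarSeminorm F) : CStarAlgebra p.Completed where
  star_smul := p.star_smul'
  norm_mul_self_le := p.norm_mul_self_le'

/-- The canonical *-homomorphism of `F` to the completion. -/
def toCompletedHom [StarModule ℂ F] (p : CStarSeminorm F) : F →⋆ₐ[ℂ] p.Completed where
  toFun := p.toCompleted
  map_one' := rfl
  map_mul' := p.toCompleted_mul
  map_zero' := rfl
  map_add' := p.toCompleted_add
  commutes' c := by
    rw [Algebra.algebraMap_eq_smul_one, toCompleted_smul, Algebra.algebraMap_eq_smul_one]
    rfl
  map_star' a := (p.star_toCompleted a).symm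

/-- The pointwise supremum of a pointwise bounded set of C*-seminorms. -/
def supremum (S : Set (CStarSeminorm F))
    (hS : ∀ a : F, BddAbove (Set.range fun p : S => p.1 a)) : CStarSeminorm F where
  toFun a := ⨆ p : S, p.1 a
  map_zero' := by
    have h : ∀ p : CStarSeminorm F, p 0 = 0 := fun p => map_zero p.toSeminorm
    simp [h]
  add_le' a b := Real.iSup_le
    (fun p => (map_add_le_add p.1.toSeminorm a b).trans
      (add_le_add (le_ciSup (hS a) p) (le_ciSup (hS b) p)))
    (add_nonneg (Real.iSup_nonneg fun p => p.1.nonneg a) (Real.iSup_nonneg fun p => p.1.nonneg b))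
  neg' a := by
    have h : ∀ p : CStarSeminorm F, p (-a) = p a := fun p => map_neg_eq_map p.toSeminorm a
    simp [h]
  smul' c a := by
    have h : ∀ p : CStarSeminorm F, p (c • a) = ‖c‖ * p a :=
      fun p => map_smul_eq_mul p.toSeminorm c a
    simp only [h]
    exact (Real.mul_iSup_of_nonneg (norm_nonneg c) _).symm
  mul_le' a b := Real.iSup_le
    (fun p => (p.1.mul_le a b).trans
      (mul_le_mul (le_ciSup (hS a) p) (le_ciSup (hS b) p) (p.1.nonneg b)
        (Real.iSup_nonneg fun p => p.1.nonneg a)))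
    (mul_nonneg (Real.iSup_nonneg fun p => p.1.nonneg a) (Real.iSup_nonneg fun p => p.1.nonneg b))
  star_mul_self' a := by
    have h0 : 0 ≤ ⨆ p : S, p.1 a := Real.iSup_nonneg fun p => p.1.nonneg a
    have hb : BddAbove (Set.range fun p : S => p.1 (star a * a)) := hS _
    apply le_antisymm
    · refine Real.iSup_le (fun p => ?_) (mul_nonneg h0 h0)
      rw [p.1.star_mul_self]
      exact mul_self_le_mul_self (p.1.nonneg a) (le_ciSup (hS a) p)
    · have h1 : 0 ≤ ⨆ p : S, p.1 (star a * a) := Real.iSup_nonneg fun p => p.1.nonneg _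
      rw [← sq, ← Real.le_sqrt h0 h1]
      refine Real.iSup_le (fun p => Real.le_sqrt_of_sq_le ?_) (Real.sqrt_nonneg _)
      rw [sq, ← p.1.star_mul_self]
      exact le_ciSup hb p

theorem supremum_apply (S : Set (CStarSeminorm F))
    (hS : ∀ a : F, BddAbove (Set.range fun p : S => p.1 a)) (a : F) :
    supremum S hS a = ⨆ p : S, p.1 a := rfl

end CStarSeminorm

/-! ### Noncommutative polynomials in self-adjoint variables, universal C*-algebras -/

/-- Noncommutative complex polynomials in the variables `X i`, `i : ι`. -/
abbrev NCPoly (ι : Type u) : Type u := MonoidAlgebra ℂ (FreeMonoid ι)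

namespace NCPoly

variable {ι : Type u}

/-- The variables. -/
def X (i : ι) : NCPoly ι := MonoidAlgebra.of ℂ (FreeMonoid ι) (FreeMonoid.of i)

/-- Reversing the words and conjugating the coefficients, as a map to the opposite ring. -/
def starHom (ι : Type u) : NCPoly ι →+* (NCPoly ι)ᵐᵒᵖ :=
  MonoidAlgebra.liftNCRingHom
    ((algebraMap ℂ (NCPoly ι)ᵐᵒᵖ).comp (starRingEnd ℂ))
    (FreeMonoid.lift fun i => MulOpposite.op (X i))
    (fun c _ => Algebra.commutes (starRingEnd ℂ c) _)

theorem starHom_single (w : FreeMonoid ι) (c : ℂ) :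
    starHom ι (MonoidAlgebra.single w c) = algebraMap ℂ (NCPoly ι)ᵐᵒᵖ (starRingEnd ℂ c) *
      FreeMonoid.lift (fun i => MulOpposite.op (X i)) w :=
  MonoidAlgebra.liftNCRingHom_single _ _ _ _ _

/-- The involution for which all the variables are self-adjoint. -/
instance : Star (NCPoly ι) where
  star a := (starHom ι a).unop

theorem star_def (a : NCPoly ι) : star a = (starHom ι a).unop := rfl

theorem star_X (i : ι) : star (X i) = X i := by
  simp [star_def, X, starHom_single, MonoidAlgebra.of_apply]

theorem star_add' (a b : NCPoly ι) : star (a + b) = star a + star b := by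
  simp [star_def]

theorem star_mul' (a b : NCPoly ι) : star (a * b) = star b * star a := by
  simp [star_def]

theorem star_smul' (c : ℂ) (a : NCPoly ι) : star (c • a) = star c • star a := by
  have h : star (algebraMap ℂ (NCPoly ι) c) = algebraMap ℂ (NCPoly ι) (star c) := by
    change ((starHom ι) (MonoidAlgebra.single 1 c)).unop = _
    rw [starHom_single]
    simp
  rw [Algebra.smul_def, star_mul', h, Algebra.smul_def, Algebra.commutes]

theorem star_star' (a : NCPoly ι) : star (star a) = a := by
  induction a using MonoidAlgebra.induction_on with
  | of w =>
    induction w using FreeMonoid.inductionOn' with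
    | one => simp [star_def, ← MonoidAlgebra.one_def]
    | of_mul x w ih =>
      rw [map_mul, star_mul', star_mul', ih]
      change star (star (X x)) * _ = _
      rw [star_X, star_X]; rfl
  | add a b ha hb => rw [star_add', star_add', ha, hb]
  | smul c a ha => rw [star_smul', star_smul', ha, star_star]

instance : StarRing (NCPoly ι) where
  star_involutive := star_star'
  star_mul := star_mul'
  star_add := star_add'

instance : StarModule ℂ (NCPoly ι) where
  star_smul := star_smul'

end NCPoly

/-- A presentation of a unital C*-algebra: self-adjoint generators indexed by `ι`, with relations
`r = 0` for `r ∈ rel`. As usual, the relations have to bound the norms of the generators, for the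
universal C*-algebra to exist. -/
structure Presentation (ι : Type u) where
  rel : Set (NCPoly ι)
  bounded : ∀ i, ∃ C : ℝ, ∀ p : CStarSeminorm (NCPoly ι),
    (∀ r ∈ rel, p r = 0) → p (NCPoly.X i) ≤ C

namespace Presentation

variable {ι : Type u} (P : Presentation ι)

/-- The C*-seminorms which vanish on the relations. -/
def seminorms : Set (CStarSeminorm (NCPoly ι)) := {p | ∀ r ∈ P.rel, p r = 0}

theorem bddAbove (a : NCPoly ι) : BddAbove (Set.range fun p : P.seminorms => p.1 a) := by
  suffices h : ∃ C : ℝ, ∀ p ∈ P.seminorms, p a ≤ C by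
    obtain ⟨C, hC⟩ := h
    exact ⟨C, by rintro _ ⟨p, rfl⟩; exact hC p.1 p.2⟩
  induction a using MonoidAlgebra.induction_on with
  | of w =>
    induction w using FreeMonoid.inductionOn' with
    | one =>
      refine ⟨1, fun p _ => ?_⟩
      rw [map_one]
      have h := p.star_mul_self 1
      rw [star_one, mul_one] at h
      nlinarith [p.nonneg 1]
    | of_mul x w ih =>
      obtain ⟨C, hC⟩ := ih
      obtain ⟨D, hD⟩ := P.bounded x
      refine ⟨D * C, fun p hp => ?_⟩
      rw [map_mul]
      exact (p.mul_le _ _).trans (mul_le_mul (hD p hp) (hC p hp) (p.nonneg _)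
        ((p.nonneg _).trans (hD p hp)))
  | add a b ha hb =>
    obtain ⟨C, hC⟩ := ha
    obtain ⟨D, hD⟩ := hb
    exact ⟨C + D, fun p hp =>
      (map_add_le_add p.toSeminorm a b).trans (add_le_add (hC p hp) (hD p hp))⟩
  | smul c a ha =>
    obtain ⟨C, hC⟩ := ha
    refine ⟨‖c‖ * C, fun p hp => ?_⟩
    rw [map_smul_eq_mul p.toSeminorm c a]
    exact mul_le_mul_of_nonneg_left (hC p hp) (norm_nonneg c)

/-- The largest C*-seminorm which vanishes on the relations. -/
def universalSeminorm : CStarSeminorm (NCPoly ι) :=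
  CStarSeminorm.supremum P.seminorms P.bddAbove

/-- The universal unital C*-algebra with the given self-adjoint generators and relations. -/
abbrev Alg : Type u := P.universalSeminorm.Completed

/-- The generators of the universal C*-algebra. -/
def gen (i : ι) : P.Alg := P.universalSeminorm.toCompletedHom (NCPoly.X i)

end Presentation

/-- Self-adjoint elements whose squares sum up to `1` have norm at most `1`. -/
theorem le_one_of_sum_sq {ι κ : Type*} [Fintype κ] (p : CStarSeminorm (NCPoly ι)) (f : κ → ι)
    (h : p (∑ k, NCPoly.X (f k) * NCPoly.X (f k) - 1) = 0) (k : κ) : p (NCPoly.X (f k)) ≤ 1 := by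
  let _ : PartialOrder p.Completed := CStarAlgebra.spectralOrder _
  have _ : StarOrderedRing p.Completed := CStarAlgebra.spectralOrderedRing _
  set φ := p.toCompletedHom
  have hφ : ∀ a, ‖φ a‖ = p a := p.norm_toCompleted
  have h1 : ∑ k, star (φ (NCPoly.X (f k))) * φ (NCPoly.X (f k)) = 1 := by
    rw [← hφ, norm_eq_zero, map_sub, map_sum, map_one, sub_eq_zero] at h
    rw [← h]
    refine Finset.sum_congr rfl fun k _ => ?_
    rw [← map_star, NCPoly.star_X, map_mul]
  have h2 : star (φ (NCPoly.X (f k))) * φ (NCPoly.X (f k)) ≤ 1 := by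
    rw [← h1]
    exact Finset.single_le_sum (f := fun k => star (φ (NCPoly.X (f k))) * φ (NCPoly.X (f k)))
      (fun k _ => star_mul_self_nonneg _) (Finset.mem_univ k)
  have h3 : ‖star (φ (NCPoly.X (f k))) * φ (NCPoly.X (f k))‖ ≤ 1 :=
    (CStarAlgebra.norm_le_one_iff_of_nonneg _ (star_mul_self_nonneg _)).2 h2
  rw [CStarRing.norm_star_mul_self, hφ] at h3
  nlinarith [p.nonneg (NCPoly.X (f k))]

/-! ### The minimal (spatial) tensor product of C*-algebras -/

section Tensor

variable {A : Type u} [CStarAlgebra A] {B : Type v} [CStarAlgebra B]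
variable {H : Type u} [NormedAddCommGroup H] [InnerProductSpace ℂ H]
variable {K : Type v} [NormedAddCommGroup K] [InnerProductSpace ℂ K]

/-- The Hilbert space tensor product. -/
def HilbertTensor (H : Type u) [NormedAddCommGroup H] [InnerProductSpace ℂ H]
    (K : Type v) [NormedAddCommGroup K] [InnerProductSpace ℂ K] : Type (max u v) :=
  UniformSpace.Completion (H ⊗[ℂ] K)

section

variable (H K)

instance : NormedAddCommGroup (HilbertTensor H K) :=
  inferInstanceAs (NormedAddCommGroup (UniformSpace.Completion (H ⊗[ℂ] K)))
instance : InnerProductSpace ℂ (HilbertTensor H K) :=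
  inferInstanceAs (InnerProductSpace ℂ (UniformSpace.Completion (H ⊗[ℂ] K)))
instance : CompleteSpace (HilbertTensor H K) :=
  inferInstanceAs (CompleteSpace (UniformSpace.Completion (H ⊗[ℂ] K)))

/-- The inclusion of the algebraic tensor product into the Hilbert space tensor product. -/
def HilbertTensor.incl : H ⊗[ℂ] K →ₗᵢ[ℂ] HilbertTensor H K :=
  UniformSpace.Completion.toComplₗᵢ (𝕜 := ℂ) (E := H ⊗[ℂ] K)

theorem HilbertTensor.denseRange_incl : DenseRange (HilbertTensor.incl H K) :=
  UniformSpace.Completion.denseRange_coe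

end

/-- The tensor product `S ⊗ T` of two operators, on the Hilbert space tensor product. -/
def opTensor (S : H →L[ℂ] H) (T : K →L[ℂ] K) : HilbertTensor H K →L[ℂ] HilbertTensor H K :=
  (TensorProduct.mapL S T).completion

theorem opTensor_coe (S : H →L[ℂ] H) (T : K →L[ℂ] K) (x : H ⊗[ℂ] K) :
    opTensor S T (HilbertTensor.incl H K x) =
      HilbertTensor.incl H K (TensorProduct.mapL S T x) :=
  ContinuousLinearMap.completion_apply_coe (TensorProduct.mapL S T) x

theorem op_ext {S T : HilbertTensor H K →L[ℂ] HilbertTensor H K}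
    (h : ∀ x : H ⊗[ℂ] K, S (HilbertTensor.incl H K x) = T (HilbertTensor.incl H K x)) : S = T := by
  ext x
  exact (HilbertTensor.denseRange_incl H K).induction_on x
    (isClosed_eq S.continuous T.continuous) h

theorem opTensor_add_left (S S' : H →L[ℂ] H) (T : K →L[ℂ] K) :
    opTensor (S + S') T = opTensor S T + opTensor S' T :=
  op_ext fun x => by
    simp [opTensor_coe, TensorProduct.mapL_add_left]

theorem opTensor_add_right (S : H →L[ℂ] H) (T T' : K →L[ℂ] K) :
    opTensor S (T + T') = opTensor S T + opTensor S T' :=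
  op_ext fun x => by
    simp [opTensor_coe, TensorProduct.mapL_add_right]

theorem opTensor_smul_left (c : ℂ) (S : H →L[ℂ] H) (T : K →L[ℂ] K) :
    opTensor (c • S) T = c • opTensor S T :=
  op_ext fun x => by
    simp [opTensor_coe, TensorProduct.mapL_smul_left]

theorem opTensor_smul_right (c : ℂ) (S : H →L[ℂ] H) (T : K →L[ℂ] K) :
    opTensor S (c • T) = c • opTensor S T :=
  op_ext fun x => by
    simp [opTensor_coe, TensorProduct.mapL_smul_right]

theorem opTensor_mul (S S' : H →L[ℂ] H) (T T' : K →L[ℂ] K) :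
    opTensor (S * S') (T * T') = opTensor S T * opTensor S' T' :=
  op_ext fun x => by
    simp [opTensor_coe, TensorProduct.mapL_mul]

theorem opTensor_one : opTensor (1 : H →L[ℂ] H) (1 : K →L[ℂ] K) = 1 :=
  op_ext fun x => by
    rw [opTensor_coe]
    exact congrArg _ (DFunLike.congr_fun TensorProduct.mapL_id_id x)

theorem norm_opTensor_le (S : H →L[ℂ] H) (T : K →L[ℂ] K) : ‖opTensor S T‖ ≤ ‖S‖ * ‖T‖ := by
  refine ContinuousLinearMap.opNorm_le_bound _ (by positivity) fun x => ?_
  refine (HilbertTensor.denseRange_incl H K).induction_on x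
    (isClosed_le (by fun_prop) (by fun_prop)) fun x => ?_
  · rw [opTensor_coe, LinearIsometry.norm_map, LinearIsometry.norm_map]
    exact ContinuousLinearMap.le_of_opNorm_le _ (TensorProduct.norm_mapL_le S T) x

variable [CompleteSpace H] [CompleteSpace K]

theorem opTensor_star (S : H →L[ℂ] H) (T : K →L[ℂ] K) :
    opTensor (star S) (star T) = star (opTensor S T) := by
  refine (ContinuousLinearMap.eq_adjoint_iff _ _).2 fun x y => ?_
  refine (HilbertTensor.denseRange_incl H K).induction_on₂
    (isClosed_eq (by fun_prop) (by fun_prop)) (fun x y => ?_) x y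
  · rw [opTensor_coe, opTensor_coe, LinearIsometry.inner_map_map, LinearIsometry.inner_map_map]
    induction x with
    | zero => simp
    | add x x' hx hx' => simp only [map_add, inner_add_left, hx, hx']
    | tmul h k =>
      induction y with
      | zero => simp
      | add y y' hy hy' => simp only [map_add, inner_add_right, hy, hy']
      | tmul h' k' =>
        simp [TensorProduct.inner_tmul, ContinuousLinearMap.star_eq_adjoint,
          ContinuousLinearMap.adjoint_inner_left]

/-- The operators `π(a) ⊗ 1`. -/
def leftRep (K : Type v) [NormedAddCommGroup K] [InnerProductSpace ℂ K]
    (π : A →⋆ₐ[ℂ] (H →L[ℂ] H)) :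
    A →ₐ[ℂ] (HilbertTensor H K →L[ℂ] HilbertTensor H K) :=
  AlgHom.ofLinearMap
    { toFun := fun a => opTensor (π a) (1 : K →L[ℂ] K)
      map_add' := fun a b => by rw [map_add, opTensor_add_left]
      map_smul' := fun c a => by rw [map_smul, opTensor_smul_left]; rfl }
    (by simp [opTensor_one])
    (fun a b => by simp [← opTensor_mul])

/-- The operators `1 ⊗ ρ(b)`. -/
def rightRep (H : Type u) [NormedAddCommGroup H] [InnerProductSpace ℂ H]
    (ρ : B →⋆ₐ[ℂ] (K →L[ℂ] K)) :
    B →ₐ[ℂ] (HilbertTensor H K →L[ℂ] HilbertTensor H K) :=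
  AlgHom.ofLinearMap
    { toFun := fun b => opTensor (1 : H →L[ℂ] H) (ρ b)
      map_add' := fun a b => by rw [map_add, opTensor_add_right]
      map_smul' := fun c a => by rw [map_smul, opTensor_smul_right]; rfl }
    (by simp [opTensor_one])
    (fun a b => by simp [← opTensor_mul])

theorem leftRep_mul_rightRep (π : A →⋆ₐ[ℂ] (H →L[ℂ] H)) (ρ : B →⋆ₐ[ℂ] (K →L[ℂ] K))
    (a : A) (b : B) : leftRep K π a * rightRep H ρ b = opTensor (π a) (ρ b) := by
  change opTensor (π a) 1 * opTensor 1 (ρ b) = _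
  rw [← opTensor_mul, mul_one, one_mul]

theorem leftRep_commute_rightRep (π : A →⋆ₐ[ℂ] (H →L[ℂ] H)) (ρ : B →⋆ₐ[ℂ] (K →L[ℂ] K))
    (a : A) (b : B) : Commute (leftRep K π a) (rightRep H ρ b) := by
  change _ = _
  rw [leftRep_mul_rightRep]
  change _ = opTensor 1 (ρ b) * opTensor (π a) 1
  rw [← opTensor_mul, mul_one, one_mul]

/-- The tensor product `π ⊗ ρ` of two representations, as an algebra homomorphism. -/
def tensorRepAux (π : A →⋆ₐ[ℂ] (H →L[ℂ] H)) (ρ : B →⋆ₐ[ℂ] (K →L[ℂ] K)) :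
    A ⊗[ℂ] B →ₐ[ℂ] (HilbertTensor H K →L[ℂ] HilbertTensor H K) :=
  Algebra.TensorProduct.lift (leftRep K π) (rightRep H ρ) (leftRep_commute_rightRep π ρ)

theorem tensorRepAux_tmul (π : A →⋆ₐ[ℂ] (H →L[ℂ] H)) (ρ : B →⋆ₐ[ℂ] (K →L[ℂ] K))
    (a : A) (b : B) : tensorRepAux π ρ (a ⊗ₜ b) = opTensor (π a) (ρ b) := by
  rw [tensorRepAux, Algebra.TensorProduct.lift_tmul, leftRep_mul_rightRep]

/-- The tensor product `π ⊗ ρ` of two representations, `a ⊗ b ↦ π(a) ⊗ ρ(b)`. -/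
def tensorRep (π : A →⋆ₐ[ℂ] (H →L[ℂ] H)) (ρ : B →⋆ₐ[ℂ] (K →L[ℂ] K)) :
    A ⊗[ℂ] B →⋆ₐ[ℂ] (HilbertTensor H K →L[ℂ] HilbertTensor H K) where
  __ := tensorRepAux π ρ
  map_star' t := by
    change tensorRepAux π ρ (star t) = star (tensorRepAux π ρ t)
    induction t with
    | zero => simp
    | add s t hs ht => simp [hs, ht]
    | tmul a b =>
      rw [TensorProduct.star_tmul, tensorRepAux_tmul, tensorRepAux_tmul, map_star, map_star,
        opTensor_star]

theorem tensorRep_tmul (π : A →⋆ₐ[ℂ] (H →L[ℂ] H)) (ρ : B →⋆ₐ[ℂ] (K →L[ℂ] K))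
    (a : A) (b : B) : tensorRep π ρ (a ⊗ₜ b) = opTensor (π a) (ρ b) :=
  tensorRepAux_tmul π ρ a b

/-- The C*-seminorm `t ↦ ‖(π ⊗ ρ)(t)‖` on the algebraic tensor product `A ⊗ B`. -/
def tensorRepSeminorm (π : A →⋆ₐ[ℂ] (H →L[ℂ] H)) (ρ : B →⋆ₐ[ℂ] (K →L[ℂ] K)) :
    CStarSeminorm (A ⊗[ℂ] B) where
  toFun t := ‖tensorRep π ρ t‖
  map_zero' := by simp
  add_le' s t := by rw [map_add]; exact norm_add_le _ _
  neg' t := by rw [map_neg, norm_neg]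
  smul' c t := by rw [map_smul, norm_smul]
  mul_le' s t := by rw [map_mul]; exact norm_mul_le _ _
  star_mul_self' t := by rw [map_mul, map_star, CStarRing.norm_star_mul_self]

theorem tensorRepSeminorm_apply (π : A →⋆ₐ[ℂ] (H →L[ℂ] H)) (ρ : B →⋆ₐ[ℂ] (K →L[ℂ] K))
    (t : A ⊗[ℂ] B) : tensorRepSeminorm π ρ t = ‖tensorRep π ρ t‖ := rfl

variable (A B)

/-- All the C*-seminorms on `A ⊗ B` coming from a representation of `A` on a Hilbert space and
a representation of `B` on a Hilbert space. -/
def spatialSeminorms : Set (CStarSeminorm (A ⊗[ℂ] B)) :=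
  {p | ∃ (H : Type u) (_ : NormedAddCommGroup H) (_ : InnerProductSpace ℂ H) (_ : CompleteSpace H)
    (K : Type v) (_ : NormedAddCommGroup K) (_ : InnerProductSpace ℂ K) (_ : CompleteSpace K)
    (π : A →⋆ₐ[ℂ] (H →L[ℂ] H)) (ρ : B →⋆ₐ[ℂ] (K →L[ℂ] K)), p = tensorRepSeminorm π ρ}

theorem spatialSeminorms_bddAbove (t : A ⊗[ℂ] B) :
    BddAbove (Set.range fun p : spatialSeminorms A B => p.1 t) := by
  suffices h : ∃ C : ℝ, ∀ p ∈ spatialSeminorms A B, p t ≤ C by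
    obtain ⟨C, hC⟩ := h
    exact ⟨C, by rintro _ ⟨p, rfl⟩; exact hC p.1 p.2⟩
  induction t with
  | zero => exact ⟨0, fun p _ => le_of_eq (map_zero p.toSeminorm)⟩
  | add s t hs ht =>
    obtain ⟨C, hC⟩ := hs
    obtain ⟨D, hD⟩ := ht
    exact ⟨C + D, fun p hp =>
      (map_add_le_add p.toSeminorm s t).trans (add_le_add (hC p hp) (hD p hp))⟩
  | tmul a b =>
    refine ⟨‖a‖ * ‖b‖, ?_⟩
    rintro _ ⟨H, _, _, _, K, _, _, _, π, ρ, rfl⟩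
    rw [tensorRepSeminorm_apply, tensorRep_tmul]
    exact (norm_opTensor_le _ _).trans (mul_le_mul
      (NonUnitalStarAlgHom.norm_apply_le π a) (NonUnitalStarAlgHom.norm_apply_le ρ b)
      (norm_nonneg _) (norm_nonneg _))

/-- The minimal (spatial) C*-norm on `A ⊗ B`. -/
def spatialNorm : CStarSeminorm (A ⊗[ℂ] B) :=
  CStarSeminorm.supremum (spatialSeminorms A B) (spatialSeminorms_bddAbove A B)

/-- The minimal (spatial) tensor product of two C*-algebras. -/
abbrev MinTensor : Type (max u v) := (spatialNorm A B).Completed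

variable {A B}

/-- The elementary tensor `a ⊗ b` in the minimal tensor product. -/
def MinTensor.tmul (a : A) (b : B) : MinTensor A B :=
  (spatialNorm A B).toCompletedHom (a ⊗ₜ[ℂ] b)

end Tensor

/-! ### Noncommutative spheres -/

open NCPoly in
/-- The twisted polygonal sphere `S̄^{N-1,d-1}_ℝ`: the algebra of continuous functions on it is the
universal C*-algebra generated by self-adjoint `x_1, …, x_N` with `∑ x_i² = 1`, with
`x_i x_j = - x_j x_i` for `i ≠ j`, and with `x_{i_0} ⋯ x_{i_d} = 0` for `i_0, …, i_d` distinct. -/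
def twistedPolygonalSphere (N d : ℕ) : Presentation (Fin N) where
  rel := {∑ i, X i * X i - 1} ∪
    {r | ∃ i j : Fin N, i ≠ j ∧ r = X i * X j + X j * X i} ∪
    {r | ∃ f : Fin (d + 1) → Fin N, Function.Injective f ∧
      r = (List.ofFn fun k => X (f k)).prod}
  bounded i := ⟨1, fun p hp => le_one_of_sum_sq p id (hp _ (Or.inl (Or.inl rfl))) i⟩

/-! ### Compact quantum groups -/

/-- The pair `(A, w)` is `(C(G), u)` for a closed quantum subgroup `G ⊂ O_N^+`, in the sense of
Woronowicz: `w` is an orthogonal matrix, with self-adjoint entries which generate the C*-algebra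
`A`; the comultiplication is defined on `A`, and the counit and the antipode (which need not be
bounded for the norm of `A`) are defined on the dense *-algebra generated by the entries. -/
structure IsQuantumGroup {N : ℕ} {A : Type u} [CStarAlgebra A] (w : Fin N → Fin N → A) :
    Prop where
  selfAdjoint : ∀ i j, star (w i j) = w i j
  row : ∀ i j, ∑ k, w i k * w j k = if i = j then 1 else 0
  column : ∀ i j, ∑ k, w k i * w k j = if i = j then 1 else 0
  dense : (StarAlgebra.adjoin ℂ (Set.range (Function.uncurry w))).topologicalClosure = ⊤
  comul : ∃ Δ : A →⋆ₐ[ℂ] MinTensor A A, ∀ i j,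
    Δ (w i j) = ∑ k, MinTensor.tmul (w i k) (w k j)
  counit : ∃ ε : StarAlgebra.adjoin ℂ (Set.range (Function.uncurry w)) →⋆ₐ[ℂ] ℂ,
    ∀ i j a, a.1 = w i j → ε a = if i = j then 1 else 0
  antipode : ∃ S : StarAlgebra.adjoin ℂ (Set.range (Function.uncurry w)) →⋆ₐ[ℂ]
      (StarAlgebra.adjoin ℂ (Set.range (Function.uncurry w)))ᵐᵒᵖ,
    ∀ i j a, a.1 = w i j → (S a).unop.1 = w j i

/-- The quantum group with algebra and coordinates `(A, w)` acts affinely on the noncommutative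
manifold `M`: there is a morphism of C*-algebras `C(M) → A ⊗ C(M)`, `x_i ↦ ∑_j w_{ij} ⊗ x_j`. -/
def ActsAffinely {N : ℕ} {A : Type u} [CStarAlgebra A] (w : Fin N → Fin N → A)
    (M : Presentation (Fin N)) : Prop :=
  ∃ Φ : M.Alg →⋆ₐ[ℂ] MinTensor A M.Alg, ∀ i,
    Φ (M.gen i) = ∑ j, MinTensor.tmul (w i j) (M.gen j)

/-- `(A, w)` is the quantum isometry group of `M`: the largest closed quantum subgroup of `O_N^+`
which acts affinely on `M`. -/
structure IsQuantumIsometryGroup {N : ℕ} {A : Type u} [CStarAlgebra A] (w : Fin N → Fin N → A)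
    (M : Presentation (Fin N)) : Prop where
  isQuantumGroup : IsQuantumGroup w
  actsAffinely : ActsAffinely w M
  universal : ∀ (B : Type v) [CStarAlgebra B] (z : Fin N → Fin N → B),
    IsQuantumGroup z → ActsAffinely z M → ∃ θ : A →⋆ₐ[ℂ] B, ∀ i j, θ (w i j) = z i j

/-! ### The free, twisted and classical groups -/

/-- The coordinates `u_{ij}`, as noncommutative polynomials. -/
def coord {N : ℕ} (i j : Fin N) : NCPoly (Fin N × Fin N) := NCPoly.X (i, j)

/-- The defining relations of `O_N^+`: the matrix `u` is orthogonal. -/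
def orthogonalRel (N : ℕ) : Set (NCPoly (Fin N × Fin N)) :=
  {r | ∃ i j : Fin N, r = ∑ k, coord i k * coord j k - if i = j then 1 else 0} ∪
    {r | ∃ i j : Fin N, r = ∑ k, coord k i * coord k j - if i = j then 1 else 0}

/-- The closed subspace of `O_N^+` defined by the relations `r = 0`, `r ∈ R`. -/
def subspaceOfFreeOrthogonal (N : ℕ) (R : Set (NCPoly (Fin N × Fin N))) :
    Presentation (Fin N × Fin N) where
  rel := orthogonalRel N ∪ R
  bounded ij := ⟨1, fun p hp => le_one_of_sum_sq p (fun k => (ij.1, k))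
    (hp _ (Or.inl (Or.inl ⟨ij.1, ij.1, by simp [coord]⟩))) ij.2⟩

/-- The free hyperoctahedral group `H_N^+ ⊂ O_N^+`: `ab = 0` for any `a ≠ b` on the same row or the
same column of `u`. -/
def freeHyperoctahedral (N : ℕ) : Presentation (Fin N × Fin N) :=
  subspaceOfFreeOrthogonal N
    ({r | ∃ i j k : Fin N, j ≠ k ∧ r = coord i j * coord i k} ∪
      {r | ∃ i j k : Fin N, j ≠ k ∧ r = coord j i * coord k i})

/-- The twisted orthogonal group `Ō_N ⊂ O_N^+`: `ab = -ba` for any `a ≠ b` on the same row or the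
same column of `u`, and `ab = ba` otherwise. -/
def twistedOrthogonal (N : ℕ) : Presentation (Fin N × Fin N) :=
  subspaceOfFreeOrthogonal N
    ({r | ∃ i j k l : Fin N, (i, j) ≠ (k, l) ∧ (i = k ∨ j = l) ∧
        r = coord i j * coord k l + coord k l * coord i j} ∪
      {r | ∃ i j k l : Fin N, ¬ ((i, j) ≠ (k, l) ∧ (i = k ∨ j = l)) ∧
        r = coord i j * coord k l - coord k l * coord i j})

/-- The signed permutation matrix sending the basis vector `e_j` to `s_j e_{σ j}`. -/
def signedPermMatrix {N : ℕ} (σ : Equiv.Perm (Fin N)) (s : Fin N → ℤˣ) :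
    Matrix (Fin N) (Fin N) ℝ :=
  Matrix.of fun i j => if i = σ j then ((s j : ℤ) : ℝ) else 0

/-- The hyperoctahedral group `H_N ⊂ O_N`, the group of signed permutation matrices, as a
(finite) space of matrices. -/
def hyperoctahedral (N : ℕ) : Set (Matrix (Fin N) (Fin N) ℝ) :=
  Set.range fun q : Equiv.Perm (Fin N) × (Fin N → ℤˣ) => signedPermMatrix q.1 q.2

instance (N : ℕ) : Finite (hyperoctahedral N) := Set.finite_range _

/-- The coordinate functions `g ↦ g_{ij}` on `H_N`. -/
def hyperoctahedralCoord {N : ℕ} (i j : Fin N) : C(hyperoctahedral N, ℂ) where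
  toFun g := (g.1 i j : ℂ)
  continuous_toFun := Complex.continuous_ofReal.comp
    ((continuous_apply j).comp ((continuous_apply i).comp continuous_subtype_val))

end QIso

end

namespace QIso

noncomputable section

/-! ### Representations separate the points of a C*-algebra -/

section States

variable {A : Type u} [CStarAlgebra A]

/-! An affine action sends points of the sphere to points of the sphere, and finitely many kinds of
matrix points suffice to recover the relations between the entries `w i j`. If self-adjoint matrices
`x j` satisfy the sphere relations, they define a representation `ψ` of the sphere algebra, and
applying `id ⊗ ψ` to `∑ w i j ⊗ x j` gives matrices over `A` that satisfy the same relations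
(`ActsAffinely.isSpherePoint`). This needs `id ⊗ ψ` to vanish on the null space of the minimal norm,
which holds because Hilbert space representations separate the points of `A` (Hahn–Banach and GNS).

Coordinate points show that each column of `w` is a point of the sphere. At d = 1 this makes
distinct entries of a column have product zero; the antipode, which transposes and reverses
products, gives the same on rows. For d ≥ 2 there are also points with two nonzero coordinates,
multiples of two anticommuting Pauli matrices. They give `[w i a, w j b] = [w i b, w j a]`; the
antipode turns the same identity, with rows and columns exchanged, into `[w i a, w j b] = -[w i b, w
j a]`, so both commutators vanish. With anticommutation on rows and columns this is `IsTwisted`,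
which settles d = N.

At d = 2 the vanishing of triple products at the Pauli points gives a cubic identity in the entries.
After moving the factor from column b to the right, multiplying by `w k b` and summing over b, row
orthogonality leaves `w i a * w j a = 0`. So `w` is both cubic and twisted, hence has commuting
entries, and Gelfand duality maps C(H_N) onto the coordinates of `w`.

Conversely, each of the three matrices acts because `∑ w i j ⊗ x j` satisfies the sphere relations,
and is a quantum group because its relations pass to `w ⊗ w`, to the identity matrix and to the
transpose over the opposite algebra. -/

theorem im_eq_zero_of_isSelfAdjoint (g : StrongDual ℂ A) (hg : ‖g‖ ≤ 1) (h1 : g 1 = 1)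
    {h : A} (hh : IsSelfAdjoint h) : (g h).im = 0 := by
  -- Evaluate `g` on `h + it`: by the C*-identity the squared norm of this element is at most `‖h‖²
  -- + t²`, while the imaginary part of its image is `(g h).im + t`.
  have key : ∀ t : ℝ, ((g h).im + t) ^ 2 ≤ ‖h‖ ^ 2 + t ^ 2 := by
    intro t
    set y : A := h + ((t : ℂ) * Complex.I) • (1 : A) with hy
    have hgy : g y = g h + (t : ℂ) * Complex.I := by simp [hy, h1]
    have h2 : ‖g y‖ ^ 2 ≤ ‖y‖ ^ 2 := by
      have := g.le_of_opNorm_le hg y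
      rw [one_mul] at this
      gcongr
    have h3 : ‖y‖ ^ 2 ≤ ‖h‖ ^ 2 + t ^ 2 := by
      have hyy : star y * y = h * h + ((t : ℂ) ^ 2) • (1 : A) := by
        rw [hy, star_add, star_smul, hh.star_eq, star_one, add_mul, mul_add, mul_add]
        simp only [smul_mul_assoc, mul_smul_comm, one_mul, mul_one, smul_smul]
        have e1 : star ((t : ℂ) * Complex.I) = -((t : ℂ) * Complex.I) := by simp
        have e2 : ((t : ℂ) * Complex.I) * -((t : ℂ) * Complex.I) = (t : ℂ) ^ 2 := by
          linear_combination (-(t : ℂ) ^ 2) * Complex.I_sq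
        rw [e1, e2, neg_smul]
        abel
      rw [sq, ← CStarRing.norm_star_mul_self, hyy]
      refine (norm_add_le _ _).trans (add_le_add ?_ ?_)
      · rw [sq]; exact norm_mul_le _ _
      · rw [norm_smul]
        rcases subsingleton_or_nontrivial A with hA | hA
        · rw [Subsingleton.elim (1 : A) 0]; simp; positivity
        · simp
    have h4 : ((g h).im + t) ^ 2 ≤ ‖g y‖ ^ 2 := by
      have h5 := Complex.abs_im_le_norm (g y)
      rw [hgy] at h5 ⊢
      have e : (g h + (t : ℂ) * Complex.I).im = (g h).im + t := by simp
      rw [e] at h5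
      rw [← sq_abs]
      gcongr
    linarith
  by_contra hne
  -- For this `t` the cross term `2 t (g h).im` equals `‖h‖² + 1`, which exceeds the allowed `‖h‖²`.
  have h1 := key ((‖h‖ ^ 2 + 1) / (2 * (g h).im))
  have h2 : 2 * (g h).im * ((‖h‖ ^ 2 + 1) / (2 * (g h).im)) = ‖h‖ ^ 2 + 1 := by
    field_simp
  nlinarith [sq_nonneg (g h).im]

/-- A functional of norm at most one taking the value one at the unit is positive. -/
theorem nonneg_of_norm_le_one [PartialOrder A] [StarOrderedRing A] (g : StrongDual ℂ A)
    (hg : ‖g‖ ≤ 1) (h1 : g 1 = 1) {x : A} (hx : 0 ≤ x) : 0 ≤ (g x).re := by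
  have hsa : IsSelfAdjoint x := .of_nonneg hx
  have hle : x ≤ algebraMap ℝ A ‖x‖ := hsa.le_algebraMap_norm_self
  -- The element `‖x‖ - x` lies between 0 and `‖x‖`, so its image `‖x‖ - g x` has modulus at most
  -- `‖x‖`, which forces a nonnegative real part of `g x`.
  have hn : ‖algebraMap ℝ A ‖x‖ - x‖ ≤ ‖x‖ := by
    rw [CStarAlgebra.norm_le_iff_le_algebraMap _ (norm_nonneg x) (sub_nonneg.2 hle)]
    exact sub_le_self _ hx
  have h2 : ‖g (algebraMap ℝ A ‖x‖ - x)‖ ≤ ‖x‖ := by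
    have := g.le_of_opNorm_le hg (algebraMap ℝ A ‖x‖ - x)
    rw [one_mul] at this
    exact this.trans hn
  have h3 : g (algebraMap ℝ A ‖x‖) = (‖x‖ : ℂ) := by
    have : algebraMap ℝ A ‖x‖ = (‖x‖ : ℂ) • (1 : A) := by
      rw [Algebra.algebraMap_eq_smul_one, Complex.coe_smul]
    rw [this, map_smul, h1, smul_eq_mul, mul_one]
  have h4 := (Complex.re_le_norm _).trans h2
  rw [map_sub, h3, Complex.sub_re, Complex.ofReal_re] at h4
  linarith

open scoped ComplexOrder in
/-- For a nonzero positive element there is a positive functional which is nonzero on it. -/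
theorem exists_positiveLinearMap_ne_zero [PartialOrder A] [StarOrderedRing A] {b : A} (hb : 0 ≤ b)
    (hb0 : b ≠ 0) : ∃ f : A →ₚ[ℂ] ℂ, f b ≠ 0 := by
  have : Nontrivial A := ⟨b, 0, hb0⟩
  -- Since `b` is positive, `‖b‖` is in its spectrum, so `1 + ‖b‖` is in that of `1 + b`.
  have hnorm : 1 + ‖b‖ ≤ ‖1 + b‖ := by
    have hmem : ‖b‖ ∈ spectrum ℝ b := CStarAlgebra.norm_mem_spectrum_of_nonneg
    have hmem' : ‖b‖ + 1 ∈ spectrum ℝ (algebraMap ℝ A 1 + b) :=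
      spectrum.add_mem_add_iff.2 hmem
    rw [map_one] at hmem'
    have := spectrum.norm_le_norm_of_mem hmem'
    rwa [Real.norm_of_nonneg (by positivity), add_comm] at this
  -- A functional norming `1 + b` must attain both bounds `|g 1| ≤ 1` and `|g b| ≤ ‖b‖`, so it is a
  -- state with value `‖b‖` at `b`.
  obtain ⟨g, hg, hgb⟩ := exists_dual_vector'' ℂ (1 + b)
  have hg1 : ‖g 1‖ ≤ 1 := by simpa using g.le_of_opNorm_le hg 1
  have hgb' : ‖g b‖ ≤ ‖b‖ := by simpa using g.le_of_opNorm_le hg b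
  have hre : (g 1).re + (g b).re = ‖1 + b‖ := by
    have := congrArg Complex.re hgb
    simpa using this
  have r1 := Complex.re_le_norm (g 1)
  have r2 := Complex.re_le_norm (g b)
  have e1 : (g 1).re = 1 := by linarith
  have e2 : (g b).re = ‖b‖ := by linarith
  have h1 : g 1 = 1 := by
    apply Complex.ext
    · simpa using e1
    · have h5 := Complex.sq_norm (g 1)
      rw [Complex.normSq_apply, e1] at h5
      have : (g 1).im * (g 1).im ≤ 0 := by nlinarith [norm_nonneg (g 1)]
      simpa using mul_self_eq_zero.1 (le_antisymm this (mul_self_nonneg _))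
  refine ⟨PositiveLinearMap.mk₀ (g : A →ₗ[ℂ] ℂ) fun x hx => ?_, fun h => ?_⟩
  · rw [Complex.nonneg_iff]
    exact ⟨nonneg_of_norm_le_one g hg h1 hx,
      (im_eq_zero_of_isSelfAdjoint g hg h1 (.of_nonneg hx)).symm⟩
  · have h' : g b = 0 := h
    rw [h', Complex.zero_re] at e2
    exact hb0 (norm_eq_zero.1 e2.symm)

/-- The representations of a C*-algebra on Hilbert spaces separate its points. -/
theorem eq_zero_of_forall_rep (a : A)
    (h : ∀ (H : Type u) [NormedAddCommGroup H] [InnerProductSpace ℂ H] [CompleteSpace H]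
      (π : A →⋆ₐ[ℂ] (H →L[ℂ] H)), π a = 0) : a = 0 := by
  let _ : PartialOrder A := CStarAlgebra.spectralOrder _
  have _ : StarOrderedRing A := CStarAlgebra.spectralOrderedRing _
  by_contra ha
  have ha' : star a * a ≠ 0 := fun h => ha (CStarRing.star_mul_self_eq_zero_iff a |>.1 h)
  obtain ⟨f, hf⟩ := exists_positiveLinearMap_ne_zero (star_mul_self_nonneg a) ha'
  -- In the GNS representation of `f`, the vector of 1 is sent by `a` to a vector of squared norm `f
  -- (star a * a)`, which is nonzero.
  have h1 := DFunLike.congr_fun (h f.GNS f.gnsStarAlgHom)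
    (UniformSpace.Completion.coe' (f.toPreGNS 1))
  have h2 : f.gnsStarAlgHom a (UniformSpace.Completion.coe' (f.toPreGNS 1)) =
      UniformSpace.Completion.coe' (f.toPreGNS a) := by
    change f.gnsNonUnitalStarAlgHom a _ = _
    rw [PositiveLinearMap.gnsNonUnitalStarAlgHom_apply_coe]
    simp
  rw [h2] at h1
  have h3 : ‖f.toPreGNS a‖ = 0 := by
    rw [← UniformSpace.Completion.norm_coe, h1]; simp
  have h4 := f.preGNS_norm_sq (f.toPreGNS a)
  rw [h3] at h4
  apply hf
  simpa using h4.symm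

end States

/-! ### The universal property of a presentation -/

namespace NCPoly

variable {ι : Type u}

/-- Evaluation of noncommutative polynomials. -/
def evalHom {R : Type*} [Ring R] [Algebra ℂ R] (f : ι → R) : NCPoly ι →ₐ[ℂ] R :=
  MonoidAlgebra.lift ℂ R (FreeMonoid ι) (FreeMonoid.lift f)

@[simp]
theorem evalHom_X {R : Type*} [Ring R] [Algebra ℂ R] (f : ι → R) (i : ι) :
    evalHom f (X i) = f i := by
  simp [evalHom, X]

theorem algHom_ext {R : Type*} [Ring R] [Algebra ℂ R] {φ ψ : NCPoly ι →ₐ[ℂ] R}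
    (h : ∀ i, φ (X i) = ψ (X i)) : φ = ψ :=
  (MonoidAlgebra.lift ℂ R (FreeMonoid ι)).symm.injective (FreeMonoid.hom_eq h)

theorem map_evalHom {R S : Type*} [Ring R] [Algebra ℂ R] [Ring S] [Algebra ℂ S]
    (φ : R →ₐ[ℂ] S) (f : ι → R) (a : NCPoly ι) :
    φ (evalHom f a) = evalHom (fun i => φ (f i)) a := by
  have h : φ.comp (evalHom f) = evalHom (fun i => φ (f i)) := algHom_ext fun i => by simp
  exact DFunLike.congr_fun h a

/-- Evaluation at self-adjoint elements. -/
def evalStarHom {R : Type*} [Ring R] [StarRing R] [Algebra ℂ R] [StarModule ℂ R] (f : ι → R)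
    (hf : ∀ i, star (f i) = f i) : NCPoly ι →⋆ₐ[ℂ] R where
  __ := evalHom f
  map_star' a := by
    change evalHom f (star a) = star (evalHom f a)
    induction a using MonoidAlgebra.induction_on with
    | of w =>
      induction w using FreeMonoid.inductionOn' with
      | one => rw [map_one, star_one, map_one, star_one]
      | of_mul x w ih =>
        rw [map_mul, star_mul, map_mul, ih, map_mul, star_mul]
        congr 1
        change evalHom f (star (X x)) = star (evalHom f (X x))
        rw [star_X, evalHom_X, hf]
    | add a b ha hb => rw [star_add, map_add, ha, hb, map_add, star_add]
    | smul c a ha => rw [star_smul, map_smul, ha, map_smul, star_smul]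

theorem evalStarHom_apply {R : Type*} [Ring R] [StarRing R] [Algebra ℂ R] [StarModule ℂ R]
    (f : ι → R) (hf : ∀ i, star (f i) = f i) (a : NCPoly ι) :
    evalStarHom f hf a = evalHom f a := rfl

end NCPoly

namespace CStarSeminorm

variable {F : Type u} [Ring F] [StarRing F] [Algebra ℂ F]

/-- The pullback of the norm of a C*-algebra. -/
def ofHom {C : Type v} [CStarAlgebra C] (φ : F →⋆ₐ[ℂ] C) : CStarSeminorm F where
  toFun a := ‖φ a‖
  map_zero' := by simp
  add_le' a b := by rw [map_add]; exact norm_add_le _ _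
  neg' a := by rw [map_neg, norm_neg]
  smul' c a := by rw [map_smul, norm_smul]
  mul_le' a b := by rw [map_mul]; exact norm_mul_le _ _
  star_mul_self' a := by rw [map_mul, map_star, CStarRing.norm_star_mul_self]

theorem ofHom_apply {C : Type v} [CStarAlgebra C] (φ : F →⋆ₐ[ℂ] C) (a : F) :
    ofHom φ a = ‖φ a‖ := rfl

/-- The extension of a bounded *-homomorphism to the completion. -/
theorem exists_lift [StarModule ℂ F] (p : CStarSeminorm F) {C : Type v} [CStarAlgebra C]
    (φ : F →⋆ₐ[ℂ] C) (h : ∀ a, ‖φ a‖ ≤ p a) :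
    ∃ θ : p.Completed →⋆ₐ[ℂ] C, ∀ a, θ (p.toCompletedHom a) = φ a := by
  let g : p.Pre →+* C := (φ : F →+* C)
  have hg : Continuous g := by
    refine AddMonoidHomClass.continuous_of_bound g 1 fun a => ?_
    rw [one_mul]
    exact h a
  let e : UniformSpace.Completion p.Pre →+* C := UniformSpace.Completion.extensionHom g hg
  have he : Continuous e := UniformSpace.Completion.continuous_extension
  have hcoe : ∀ a : F, e (p.toCompleted a) = φ a := fun a =>
    UniformSpace.Completion.extensionHom_coe g hg a
  let θ : p.Completed →⋆ₐ[ℂ] C :=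
    { toFun := e
      map_one' := map_one e
      map_mul' := map_mul e
      map_zero' := map_zero e
      map_add' := map_add e
      commutes' := fun c => by
        have h1 := hcoe (algebraMap ℂ F c)
        rw [AlgHomClass.commutes] at h1
        rw [← h1]
        exact congrArg e (AlgHomClass.commutes p.toCompletedHom c).symm
      map_star' := fun a => by
        have hs := p.continuous_star
        refine p.denseRange_toCompleted.induction_on a
          (isClosed_eq (he.comp hs) (he.star)) fun a => ?_
        rw [star_toCompleted]
        exact ((hcoe _).trans (map_star φ a)).trans (congrArg star (hcoe a)).symm }
  exact ⟨θ, hcoe⟩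

end CStarSeminorm

namespace Presentation

variable {ι : Type u} (P : Presentation ι)

/-- The pulled back norm is one of the C*-seminorms in the defining supremum. That supremum ranges
over seminorms on the polynomials, not over C*-algebras, so `C` may live in any universe. -/
theorem norm_evalHom_le {C : Type v} [CStarAlgebra C] (f : ι → C) (hf : ∀ i, star (f i) = f i)
    (h : ∀ r ∈ P.rel, NCPoly.evalHom f r = 0) (a : NCPoly ι) :
    ‖NCPoly.evalHom f a‖ ≤ P.universalSeminorm a := by
  let p : P.seminorms := ⟨CStarSeminorm.ofHom (NCPoly.evalStarHom f hf), fun r hr => by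
    rw [CStarSeminorm.ofHom_apply, NCPoly.evalStarHom_apply, h r hr, norm_zero]⟩
  exact le_ciSup (P.bddAbove a) p

/-- The universal property of the universal C*-algebra. -/
theorem exists_lift {C : Type v} [CStarAlgebra C] (f : ι → C) (hf : ∀ i, star (f i) = f i)
    (h : ∀ r ∈ P.rel, NCPoly.evalHom f r = 0) : ∃ θ : P.Alg →⋆ₐ[ℂ] C, ∀ i, θ (P.gen i) = f i := by
  obtain ⟨θ, hθ⟩ := P.universalSeminorm.exists_lift (NCPoly.evalStarHom f hf)
    (P.norm_evalHom_le f hf h)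
  exact ⟨θ, fun i => (hθ _).trans (NCPoly.evalHom_X f i)⟩

theorem evalHom_gen (a : NCPoly ι) :
    NCPoly.evalHom P.gen a = P.universalSeminorm.toCompletedHom a := by
  have h : NCPoly.evalHom P.gen = (P.universalSeminorm.toCompletedHom : NCPoly ι →ₐ[ℂ] P.Alg) :=
    NCPoly.algHom_ext fun i => by rw [NCPoly.evalHom_X]; rfl
  exact DFunLike.congr_fun h a

/-- The generators satisfy the relations. -/
theorem evalHom_gen_rel (r : NCPoly ι) (hr : r ∈ P.rel) : NCPoly.evalHom P.gen r = 0 := by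
  rw [evalHom_gen, ← norm_eq_zero]
  refine (P.universalSeminorm.norm_toCompleted r).trans ?_
  have h : ∀ p : P.seminorms, p.1 r = 0 := fun p => p.2 r hr
  rw [universalSeminorm, CStarSeminorm.supremum_apply]
  simp [h]

theorem star_gen (i : ι) : star (P.gen i) = P.gen i := by
  rw [gen, ← map_star, NCPoly.star_X]

/-- The generators generate the universal C*-algebra. -/
theorem adjoin_gen : (StarAlgebra.adjoin ℂ (Set.range P.gen)).topologicalClosure = ⊤ := by
  rw [eq_top_iff]
  rintro a -
  refine closure_mono ?_ (P.universalSeminorm.denseRange_toCompleted a)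
  rintro _ ⟨a, rfl⟩
  change P.universalSeminorm.toCompletedHom a ∈ StarAlgebra.adjoin ℂ (Set.range P.gen)
  induction a using MonoidAlgebra.induction_on with
  | of w =>
    induction w using FreeMonoid.inductionOn' with
    | one => rw [map_one, map_one]; exact one_mem _
    | of_mul x w ih =>
      rw [map_mul, map_mul]
      exact mul_mem (StarAlgebra.subset_adjoin ℂ _ ⟨x, rfl⟩) ih
  | add a b ha hb => rw [map_add]; exact add_mem ha hb
  | smul c a ha => rw [map_smul]; exact SMulMemClass.smul_mem c ha

end Presentation

/-! ### Computing in the minimal tensor product -/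

section Tensor

variable {A : Type u} [CStarAlgebra A] {B : Type v} [CStarAlgebra B]

namespace MinTensor

theorem tmul_mul_tmul (a a' : A) (b b' : B) :
    tmul a b * tmul a' b' = tmul (a * a') (b * b') := by
  rw [tmul, tmul, ← map_mul, Algebra.TensorProduct.tmul_mul_tmul, tmul]

theorem star_tmul (a : A) (b : B) : star (tmul a b) = tmul (star a) (star b) := by
  rw [tmul, ← map_star, TensorProduct.star_tmul, tmul]

theorem one_tmul_one : tmul (1 : A) (1 : B) = 1 := by
  rw [tmul, ← Algebra.TensorProduct.one_def, map_one]

@[simp]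
theorem zero_tmul (b : B) : tmul (0 : A) b = 0 := by
  rw [tmul, TensorProduct.zero_tmul, map_zero]

@[simp]
theorem tmul_zero (a : A) : tmul a (0 : B) = 0 := by
  rw [tmul, TensorProduct.tmul_zero, map_zero]

theorem sum_tmul {κ : Type*} (s : Finset κ) (a : κ → A) (b : B) :
    tmul (∑ k ∈ s, a k) b = ∑ k ∈ s, tmul (a k) b := by
  rw [tmul, TensorProduct.sum_tmul, map_sum]; rfl

theorem tmul_sum {κ : Type*} (s : Finset κ) (a : A) (b : κ → B) :
    tmul a (∑ k ∈ s, b k) = ∑ k ∈ s, tmul a (b k) := by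
  rw [tmul, TensorProduct.tmul_sum, map_sum]; rfl

end MinTensor

/-- The homomorphism `id ⊗ ψ`, for a matrix representation `ψ`. -/
def idTensor {n : Type*} [Fintype n] [DecidableEq n] (A : Type u) [CStarAlgebra A]
    (ψ : B →ₐ[ℂ] Matrix n n ℂ) : A ⊗[ℂ] B →ₐ[ℂ] Matrix n n A :=
  ((matrixEquivTensor n ℂ A).symm : A ⊗[ℂ] Matrix n n ℂ →ₐ[ℂ] Matrix n n A).comp
    (Algebra.TensorProduct.map (AlgHom.id ℂ A) ψ)

theorem idTensor_tmul {n : Type*} [Fintype n] [DecidableEq n] (ψ : B →ₐ[ℂ] Matrix n n ℂ)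
    (a : A) (b : B) (p q : n) : idTensor A ψ (a ⊗ₜ b) p q = ψ b p q • a := by
  simp [idTensor, Algebra.smul_def, Algebra.commutes]

/-- `id ⊗ ψ` vanishes on the null space of the minimal norm. -/
theorem idTensor_eq_zero {n : Type v} [Fintype n] [DecidableEq n] (ψ : B →⋆ₐ[ℂ] Matrix n n ℂ)
    (t : A ⊗[ℂ] B) (ht : (spatialNorm A B).toCompletedHom t = 0) :
    idTensor A (ψ : B →ₐ[ℂ] Matrix n n ℂ) t = 0 := by
  ext p q
  refine eq_zero_of_forall_rep _ fun H _ _ _ π => ?_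
  let ρ : B →⋆ₐ[ℂ] (EuclideanSpace ℂ n →L[ℂ] EuclideanSpace ℂ n) :=
    (Matrix.toEuclideanCLM (n := n) (𝕜 := ℂ) : Matrix n n ℂ →⋆ₐ[ℂ] _).comp ψ
  have h0 : spatialNorm A B t = 0 := by
    rw [← CStarSeminorm.norm_toCompleted, norm_eq_zero]; exact ht
  have h1 : tensorRep π ρ t = 0 := by
    have hmem : tensorRepSeminorm π ρ ∈ spatialSeminorms A B :=
      ⟨H, _, _, _, EuclideanSpace ℂ n, _, _, _, π, ρ, rfl⟩
    have hle : tensorRepSeminorm π ρ t ≤ spatialNorm A B t :=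
      le_ciSup (spatialSeminorms_bddAbove A B t) ⟨_, hmem⟩
    rw [h0, tensorRepSeminorm_apply] at hle
    exact norm_le_zero_iff.1 hle
  -- The coefficient of `(π ⊗ ρ)(s)` between `h ⊗ e_p` and `h' ⊗ e_q` is the coefficient of `π`
  -- applied to the (p, q) entry of `(id ⊗ ψ)(s)`.
  have key : ∀ (s : A ⊗[ℂ] B) (h h' : H),
      inner ℂ h (π (idTensor A (ψ : B →ₐ[ℂ] Matrix n n ℂ) s p q) h') =
      inner ℂ (HilbertTensor.incl H _ (h ⊗ₜ[ℂ] EuclideanSpace.single p (1 : ℂ)))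
        (tensorRep π ρ s (HilbertTensor.incl H _ (h' ⊗ₜ[ℂ] EuclideanSpace.single q (1 : ℂ)))) := by
    intro s h h'
    induction s with
    | zero => simp
    | add s s' hs hs' =>
      rw [map_add, Matrix.add_apply, map_add, map_add, add_apply,
        add_apply, inner_add_right, inner_add_right, hs, hs']
    | tmul a b =>
      rw [idTensor_tmul, tensorRep_tmul, opTensor_coe, LinearIsometry.inner_map_map,
        TensorProduct.mapL_apply, TensorProduct.map_tmul, TensorProduct.inner_tmul, map_smul]
      have e : inner ℂ (EuclideanSpace.single p (1 : ℂ)) (ρ b (EuclideanSpace.single q (1 : ℂ))) =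
          ψ b p q := by
        simp [ρ, EuclideanSpace.inner_single_left]
      rw [smul_apply, inner_smul_right]
      erw [e]
      exact mul_comm _ _
  ext h'
  refine ext_inner_left ℂ fun h => ?_
  rw [key, h1]
  simp

/-- An affine action preserves the matrix points of a noncommutative manifold. -/
theorem ActsAffinely.evalHom_matrix {N : ℕ} {w : Fin N → Fin N → A} {M : Presentation (Fin N)}
    (hw : ActsAffinely w M) {n : Type} [Fintype n] [DecidableEq n] (x : Fin N → Matrix n n ℂ)
    (hx : ∀ i, star (x i) = x i) (hrel : ∀ r ∈ M.rel, NCPoly.evalHom x r = 0)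
    (r : NCPoly (Fin N)) (hr : r ∈ M.rel) :
    NCPoly.evalHom (fun i => (Matrix.of fun p q => ∑ j, x j p q • w i j : Matrix n n A)) r = 0 := by
  obtain ⟨Φ, hΦ⟩ := hw
  -- Operators on Euclidean space supply the C*-norm required by the universal property of `M`.
  let e : Matrix n n ℂ ≃⋆ₐ[ℂ] (EuclideanSpace ℂ n →L[ℂ] EuclideanSpace ℂ n) :=
    Matrix.toEuclideanCLM (n := n) (𝕜 := ℂ)
  obtain ⟨θ, hθ⟩ := M.exists_lift (fun i => e (x i)) (fun i => by rw [← map_star, hx])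
    fun r hr => by
      have h := NCPoly.map_evalHom (AlgHomClass.toAlgHom e) x r
      rw [hrel r hr, map_zero] at h
      exact h.symm
  let ψ : M.Alg →⋆ₐ[ℂ] Matrix n n ℂ := (StarAlgHomClass.toStarAlgHom e.symm).comp θ
  have hψ : ∀ i, ψ (M.gen i) = x i := fun i => by
    change e.symm (θ (M.gen i)) = x i
    rw [hθ]; exact e.symm_apply_apply _
  -- The elements `t i` lift `Φ (x_i)` to the algebraic tensor product. There the relation holds
  -- only modulo the null space of the minimal norm, which `id ⊗ ψ` kills.
  let t : Fin N → A ⊗[ℂ] M.Alg := fun i => ∑ j, w i j ⊗ₜ M.gen j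
  let τ := (spatialNorm A M.Alg).toCompletedHom
  have h1 : τ (NCPoly.evalHom t r) = 0 := by
    have h2 := NCPoly.map_evalHom (τ : A ⊗[ℂ] M.Alg →ₐ[ℂ] MinTensor A M.Alg) t r
    have h3 : (fun i => (τ : A ⊗[ℂ] M.Alg →ₐ[ℂ] MinTensor A M.Alg) (t i)) =
        fun i => (Φ : M.Alg →ₐ[ℂ] MinTensor A M.Alg) (M.gen i) := by
      funext i
      exact (map_sum τ _ _).trans (hΦ i).symm
    rw [h3, ← NCPoly.map_evalHom, M.evalHom_gen_rel r hr, map_zero] at h2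
    exact h2
  have h4 := idTensor_eq_zero ψ _ h1
  rw [NCPoly.map_evalHom] at h4
  rw [← h4]
  congr 2
  funext i
  ext p q
  rw [map_sum, Matrix.sum_apply]
  simp [idTensor_tmul, hψ]

end Tensor

/-! ### Orthogonal matrices over C*-algebras -/

/-- Orthogonal matrices with self-adjoint entries. -/
structure IsOrthogonal {N : ℕ} {C : Type*} [Ring C] [StarRing C] (w : Fin N → Fin N → C) :
    Prop where
  selfAdjoint : ∀ i j, star (w i j) = w i j
  row : ∀ i j, ∑ k, w i k * w j k = if i = j then 1 else 0
  column : ∀ i j, ∑ k, w k i * w k j = if i = j then 1 else 0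

theorem IsQuantumGroup.isOrthogonal {N : ℕ} {A : Type u} [CStarAlgebra A]
    {w : Fin N → Fin N → A} (h : IsQuantumGroup w) : IsOrthogonal w :=
  ⟨h.selfAdjoint, h.row, h.column⟩

/-- The matrix `∑ k, w_{ik} ⊗ w'_{kj}`. -/
def tensorMul {N : ℕ} {A : Type u} [CStarAlgebra A] {B : Type v} [CStarAlgebra B]
    (w : Fin N → Fin N → A) (w' : Fin N → Fin N → B) (i j : Fin N) : MinTensor A B :=
  ∑ k, MinTensor.tmul (w i k) (w' k j)

/-- The vector `∑ j, w_{ij} ⊗ x_j`. -/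
def tensorMulVec {N : ℕ} {A : Type u} [CStarAlgebra A] {B : Type v} [CStarAlgebra B]
    (w : Fin N → Fin N → A) (x : Fin N → B) (i : Fin N) : MinTensor A B :=
  ∑ k, MinTensor.tmul (w i k) (x k)

section

variable {N : ℕ} {A : Type u} [CStarAlgebra A] {B : Type v} [CStarAlgebra B]

theorem tensorMulVec_mul (w : Fin N → Fin N → A) (x y : Fin N → B) (i j : Fin N) :
    tensorMulVec w x i * tensorMulVec w y j =
      ∑ k, ∑ l, MinTensor.tmul (w i k * w j l) (x k * y l) := by
  simp only [tensorMulVec, Finset.sum_mul_sum, MinTensor.tmul_mul_tmul]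

theorem tensorMul_mul (w : Fin N → Fin N → A) (w' : Fin N → Fin N → B) (i j p q : Fin N) :
    tensorMul w w' i p * tensorMul w w' j q =
      ∑ k, ∑ l, MinTensor.tmul (w i k * w j l) (w' k p * w' l q) :=
  tensorMulVec_mul w (fun k => w' k p) (fun k => w' k q) i j

theorem star_tensorMulVec {w : Fin N → Fin N → A} {x : Fin N → B}
    (hw : ∀ i j, star (w i j) = w i j) (hx : ∀ i, star (x i) = x i) (i : Fin N) :
    star (tensorMulVec w x i) = tensorMulVec w x i := by
  simp only [tensorMulVec, star_sum, MinTensor.star_tmul, hw, hx]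

/-- An orthogonal matrix preserves inner products: summing over i first, column orthogonality keeps
only the terms with equal inner indices. -/
theorem IsOrthogonal.sum_tensorMulVec_mul {w : Fin N → Fin N → A} (hw : IsOrthogonal w)
    (x y : Fin N → B) :
    ∑ i, tensorMulVec w x i * tensorMulVec w y i = MinTensor.tmul 1 (∑ i, x i * y i) := by
  simp only [tensorMulVec_mul]
  rw [Finset.sum_comm, MinTensor.tmul_sum]
  refine Finset.sum_congr rfl fun k _ => ?_
  rw [Finset.sum_comm]
  simp only [← MinTensor.sum_tmul, hw.column]
  rw [Finset.sum_eq_single k (fun l _ hl => by rw [if_neg (Ne.symm hl), MinTensor.zero_tmul])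
    (by simp), if_pos rfl]

theorem IsOrthogonal.tensorMul {w : Fin N → Fin N → A} {w' : Fin N → Fin N → B}
    (hw : IsOrthogonal w) (hw' : IsOrthogonal w') : IsOrthogonal (tensorMul w w') where
  selfAdjoint i j := star_tensorMulVec hw.selfAdjoint (fun k => hw'.selfAdjoint k j) i
  row i j := by
    simp only [tensorMul_mul]
    rw [Finset.sum_comm]
    have h : ∀ k, ∑ p, ∑ l, MinTensor.tmul (w i k * w j l) (w' k p * w' l p) =
        MinTensor.tmul (w i k * w j k) 1 := by
      intro k
      rw [Finset.sum_comm]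
      simp only [← MinTensor.tmul_sum, hw'.row]
      rw [Finset.sum_eq_single k (fun l _ hl => by rw [if_neg (Ne.symm hl), MinTensor.tmul_zero])
        (by simp), if_pos rfl]
    simp only [h]
    rw [← MinTensor.sum_tmul, hw.row]
    split_ifs
    · exact MinTensor.one_tmul_one
    · exact MinTensor.zero_tmul _
  column i j := by
    have h := hw.sum_tensorMulVec_mul (fun k => w' k i) (fun k => w' k j)
    rw [hw'.column] at h
    refine h.trans ?_
    split_ifs
    · exact MinTensor.one_tmul_one
    · exact MinTensor.tmul_zero _

theorem isOrthogonal_one {C : Type*} [Ring C] [StarRing C] :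
    IsOrthogonal (fun i j : Fin N => if i = j then (1 : C) else 0) where
  selfAdjoint i j := by split_ifs <;> simp
  row i j := by simp
  column i j := by simp [eq_comm]

theorem IsOrthogonal.op_transpose {C : Type*} [Ring C] [StarRing C] {w : Fin N → Fin N → C}
    (hw : IsOrthogonal w) : IsOrthogonal (fun i j => MulOpposite.op (w j i)) where
  selfAdjoint i j := by rw [← MulOpposite.op_star, hw.selfAdjoint]
  row i j := by
    simp only [← MulOpposite.op_mul, ← Finset.op_sum, hw.column, eq_comm (a := j)]
    split_ifs <;> simp
  column i j := by
    simp only [← MulOpposite.op_mul, ← Finset.op_sum, hw.row, eq_comm (a := j)]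
    split_ifs <;> simp

/-- A quantum group whose counit and antipode are bounded. -/
theorem IsOrthogonal.isQuantumGroup {w : Fin N → Fin N → A} (hw : IsOrthogonal w)
    (dense : (StarAlgebra.adjoin ℂ (Set.range (Function.uncurry w))).topologicalClosure = ⊤)
    (comul : ∃ Δ : A →⋆ₐ[ℂ] MinTensor A A, ∀ i j, Δ (w i j) = QIso.tensorMul w w i j)
    (counit : ∃ ε : A →⋆ₐ[ℂ] ℂ, ∀ i j, ε (w i j) = if i = j then 1 else 0)
    (antipode : ∃ S : A →⋆ₐ[ℂ] Aᵐᵒᵖ, ∀ i j, S (w i j) = MulOpposite.op (w j i)) :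
    IsQuantumGroup w where
  selfAdjoint := hw.selfAdjoint
  row := hw.row
  column := hw.column
  dense := dense
  comul := comul
  counit := by
    obtain ⟨ε, hε⟩ := counit
    exact ⟨ε.comp (StarSubalgebra.subtype _), fun i j a ha => (congrArg ε ha).trans (hε i j)⟩
  antipode := by
    obtain ⟨S, hS⟩ := antipode
    -- A bounded antipode permutes the generators, so it restricts to the dense *-algebra, where the
    -- definition asks for it.
    have hmem : ∀ a ∈ StarAlgebra.adjoin ℂ (Set.range (Function.uncurry w)),
        (S a).unop ∈ StarAlgebra.adjoin ℂ (Set.range (Function.uncurry w)) := by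
      intro a ha
      induction ha using StarAlgebra.adjoin_induction with
      | mem x hx =>
        obtain ⟨⟨i, j⟩, rfl⟩ := hx
        rw [Function.uncurry_apply_pair, hS]
        exact StarAlgebra.subset_adjoin ℂ _ ⟨(j, i), rfl⟩
      | algebraMap c => rw [AlgHomClass.commutes]; exact algebraMap_mem _ c
      | add x y _ _ hx hy => rw [map_add]; exact add_mem hx hy
      | mul x y _ _ hx hy => rw [map_mul]; exact mul_mem hy hx
      | star x _ hx => rw [map_star]; exact star_mem hx
    refine ⟨{
      toFun := fun a => MulOpposite.op ⟨(S a.1).unop, hmem a.1 a.2⟩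
      map_one' := ?_
      map_mul' := ?_
      map_zero' := ?_
      map_add' := ?_
      commutes' := ?_
      map_star' := ?_ }, ?_⟩
    · exact MulOpposite.unop_injective (Subtype.ext (congrArg MulOpposite.unop (map_one S)))
    · intro a b
      exact MulOpposite.unop_injective
        (Subtype.ext (congrArg MulOpposite.unop (map_mul S a.1 b.1)))
    · exact MulOpposite.unop_injective (Subtype.ext (congrArg MulOpposite.unop (map_zero S)))
    · intro a b
      exact MulOpposite.unop_injective
        (Subtype.ext (congrArg MulOpposite.unop (map_add S a.1 b.1)))
    · intro c
      exact MulOpposite.unop_injective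
        (Subtype.ext (congrArg MulOpposite.unop (AlgHomClass.commutes S c)))
    · intro a
      exact MulOpposite.unop_injective
        (Subtype.ext (congrArg MulOpposite.unop (map_star S a.1)))
    · intro i j a ha
      exact congrArg MulOpposite.unop ((congrArg S ha).trans (hS i j))

/-- The antipode transposes relations and reverses products. -/
theorem IsQuantumGroup.evalHom_op_transpose {w : Fin N → Fin N → A} (hw : IsQuantumGroup w)
    (r : NCPoly (Fin N × Fin N)) (hr : NCPoly.evalHom (Function.uncurry w) r = 0) :
    NCPoly.evalHom (fun ij : Fin N × Fin N => MulOpposite.op (w ij.2 ij.1)) r = 0 := by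
  obtain ⟨S, hS⟩ := hw.antipode
  let 𝒜 := StarAlgebra.adjoin ℂ (Set.range (Function.uncurry w))
  let a : Fin N × Fin N → 𝒜 := fun ij =>
    ⟨w ij.1 ij.2, StarAlgebra.subset_adjoin ℂ _ ⟨ij, rfl⟩⟩
  let ι : 𝒜 →ₐ[ℂ] A := (StarSubalgebra.subtype 𝒜 : 𝒜 →ₐ[ℂ] A)
  -- The antipode exists only on the dense *-algebra, so the relation is first lifted there.
  have h0 : NCPoly.evalHom a r = 0 := by
    apply Subtype.val_injective
    exact (NCPoly.map_evalHom ι a r).trans hr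
  have h1 := NCPoly.map_evalHom (ι.op.comp (S : 𝒜 →ₐ[ℂ] 𝒜ᵐᵒᵖ)) a r
  rw [h0, map_zero] at h1
  rw [h1]
  congr 2
  funext ij
  exact (congrArg MulOpposite.op (hS ij.1 ij.2 (a ij) rfl)).symm

/-! ### Subspaces of the free orthogonal group -/

theorem evalHom_ite {ι : Type*} {R : Type*} [Ring R] [Algebra ℂ R] (f : ι → R) (p : Prop)
    [Decidable p] : NCPoly.evalHom f (if p then 1 else 0) = if p then 1 else 0 := by
  split_ifs <;> simp

theorem IsOrthogonal.exists_lift {R : Set (NCPoly (Fin N × Fin N))} {z : Fin N → Fin N → B}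
    (hz : IsOrthogonal z) (hR : ∀ r ∈ R, NCPoly.evalHom (Function.uncurry z) r = 0) :
    ∃ θ : (subspaceOfFreeOrthogonal N R).Alg →⋆ₐ[ℂ] B,
      ∀ i j, θ ((subspaceOfFreeOrthogonal N R).gen (i, j)) = z i j := by
  obtain ⟨θ, hθ⟩ := (subspaceOfFreeOrthogonal N R).exists_lift (Function.uncurry z)
    (fun ij => hz.selfAdjoint ij.1 ij.2) (by
      rintro r ((⟨i, j, rfl⟩ | ⟨i, j, rfl⟩) | hr)
      · simp [coord, map_sub, map_sum, hz.row]
      · simp [coord, map_sub, map_sum, hz.column]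
      · exact hR r hr)
  exact ⟨θ, fun i j => hθ (i, j)⟩

theorem isOrthogonal_gen (R : Set (NCPoly (Fin N × Fin N))) :
    IsOrthogonal (fun i j => (subspaceOfFreeOrthogonal N R).gen (i, j)) where
  selfAdjoint i j := Presentation.star_gen _ _
  row i j := by
    have h := (subspaceOfFreeOrthogonal N R).evalHom_gen_rel _ (Or.inl (Or.inl ⟨i, j, rfl⟩))
    simpa [coord, map_sub, map_sum, evalHom_ite, sub_eq_zero] using h
  column i j := by
    have h := (subspaceOfFreeOrthogonal N R).evalHom_gen_rel _ (Or.inl (Or.inr ⟨i, j, rfl⟩))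
    simpa [coord, map_sub, map_sum, evalHom_ite, sub_eq_zero] using h

/-- Comultiplication, counit and antipode all come from the universal property. Orthogonality of the
three target matrices is automatic, so only the additional relations `R` have to be checked on them.
-/
theorem isQuantumGroup_gen (R : Set (NCPoly (Fin N × Fin N)))
    (comul : ∀ r ∈ R, NCPoly.evalHom (Function.uncurry
      (tensorMul (fun i j => (subspaceOfFreeOrthogonal N R).gen (i, j))
        (fun i j => (subspaceOfFreeOrthogonal N R).gen (i, j)))) r = 0)
    (counit : ∀ r ∈ R, NCPoly.evalHom
      (Function.uncurry fun i j : Fin N => if i = j then (1 : ℂ) else 0) r = 0)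
    (antipode : ∀ r ∈ R, NCPoly.evalHom (Function.uncurry fun i j =>
      MulOpposite.op ((subspaceOfFreeOrthogonal N R).gen (j, i))) r = 0) :
    IsQuantumGroup (fun i j => (subspaceOfFreeOrthogonal N R).gen (i, j)) :=
  (isOrthogonal_gen R).isQuantumGroup (subspaceOfFreeOrthogonal N R).adjoin_gen
    (((isOrthogonal_gen R).tensorMul (isOrthogonal_gen R)).exists_lift comul)
    (isOrthogonal_one.exists_lift counit)
    ((isOrthogonal_gen R).op_transpose.exists_lift antipode)

/-! ### Points of the twisted polygonal spheres -/

/-- The relations of the twisted polygonal sphere. -/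
structure IsSpherePoint {R : Type*} [Ring R] (d : ℕ) (x : Fin N → R) : Prop where
  sum : ∑ i, x i * x i = 1
  anticomm : ∀ i j, i ≠ j → x i * x j + x j * x i = 0
  prod : ∀ f : Fin (d + 1) → Fin N, Function.Injective f → (List.ofFn fun k => x (f k)).prod = 0

theorem isSpherePoint_iff {R : Type*} [Ring R] [Algebra ℂ R] (d : ℕ) (x : Fin N → R) :
    IsSpherePoint d x ↔ ∀ r ∈ (twistedPolygonalSphere N d).rel, NCPoly.evalHom x r = 0 := by
  constructor
  · rintro h r ((rfl | ⟨i, j, hij, rfl⟩) | ⟨f, hf, rfl⟩)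
    · simp [map_sub, map_sum, h.sum]
    · simp [h.anticomm i j hij]
    · rw [map_list_prod, List.map_ofFn, ← h.prod f hf]
      congr 2
      funext k
      exact NCPoly.evalHom_X x (f k)
  · intro h
    refine ⟨?_, fun i j hij => ?_, fun f hf => ?_⟩
    · simpa [map_sub, map_sum, sub_eq_zero] using h _ (Or.inl (Or.inl rfl))
    · simpa using h _ (Or.inl (Or.inr ⟨i, j, hij, rfl⟩))
    · rw [← h _ (Or.inr ⟨f, hf, rfl⟩), map_list_prod, List.map_ofFn]
      congr 2
      funext k
      exact (NCPoly.evalHom_X x (f k)).symm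

theorem isSpherePoint_gen (d : ℕ) : IsSpherePoint d (twistedPolygonalSphere N d).gen :=
  (isSpherePoint_iff d _).2 (twistedPolygonalSphere N d).evalHom_gen_rel

/-- The relation `∑ x_i² = 1` is preserved by every orthogonal matrix, so only the other two
families remain as hypotheses. -/
theorem IsOrthogonal.actsAffinely {w : Fin N → Fin N → A} (hw : IsOrthogonal w) {d : ℕ}
    (anticomm : ∀ i j, i ≠ j →
      tensorMulVec w (twistedPolygonalSphere N d).gen i *
          tensorMulVec w (twistedPolygonalSphere N d).gen j +
        tensorMulVec w (twistedPolygonalSphere N d).gen j *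
          tensorMulVec w (twistedPolygonalSphere N d).gen i = 0)
    (prod : ∀ f : Fin (d + 1) → Fin N, Function.Injective f →
      (List.ofFn fun k => tensorMulVec w (twistedPolygonalSphere N d).gen (f k)).prod = 0) :
    ActsAffinely w (twistedPolygonalSphere N d) := by
  refine (twistedPolygonalSphere N d).exists_lift _
    (star_tensorMulVec hw.selfAdjoint (Presentation.star_gen _)) ?_
  refine (isSpherePoint_iff d _).1 ⟨?_, anticomm, prod⟩
  refine (hw.sum_tensorMulVec_mul _ _).trans ?_
  rw [(isSpherePoint_gen d).sum, MinTensor.one_tmul_one]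

theorem ActsAffinely.isSpherePoint {w : Fin N → Fin N → A} {d : ℕ}
    (hw : ActsAffinely w (twistedPolygonalSphere N d)) {n : Type} [Fintype n] [DecidableEq n]
    {x : Fin N → Matrix n n ℂ} (hx : ∀ i, star (x i) = x i) (h : IsSpherePoint d x) :
    IsSpherePoint d
      (fun i => (Matrix.of fun p q => ∑ j, x j p q • w i j : Matrix n n A)) :=
  (isSpherePoint_iff d _).2 (hw.evalHom_matrix x hx ((isSpherePoint_iff d x).1 h))

end

/-! ### The relations of the free hyperoctahedral and of the twisted orthogonal group -/

/-- Distinct entries on the same row or on the same column have product zero. -/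
structure IsCubic {N : ℕ} {R : Type*} [Ring R] (w : Fin N → Fin N → R) : Prop where
  row : ∀ i j k, j ≠ k → w i j * w i k = 0
  column : ∀ i j k, j ≠ k → w j i * w k i = 0

/-- The sign of the commutation between the coordinates `x_i` and `x_j` of the twisted sphere. -/
def twistSign {ι : Type*} [DecidableEq ι] (i j : ι) : ℂ := if i = j then 1 else -1

theorem twistSign_self {ι : Type*} [DecidableEq ι] (i : ι) : twistSign i i = 1 := if_pos rfl

theorem twistSign_of_ne {ι : Type*} [DecidableEq ι] {i j : ι} (h : i ≠ j) : twistSign i j = -1 :=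
  if_neg h

theorem twistSign_mul_self {ι : Type*} [DecidableEq ι] (i j : ι) :
    twistSign i j * twistSign i j = 1 := by
  unfold twistSign; split_ifs <;> simp

theorem twistSign_comm {ι : Type*} [DecidableEq ι] (i j : ι) :
    twistSign i j = twistSign j i := by
  simp only [twistSign, eq_comm]

/-- Distinct entries on the same row or on the same column anticommute, and any other two entries
commute. -/
def IsTwisted {N : ℕ} {R : Type*} [Ring R] [Algebra ℂ R] (w : Fin N → Fin N → R) : Prop :=
  ∀ i j k l, w i j * w k l = (twistSign i k * twistSign j l) • (w k l * w i j)

/-- The relations of `H_N^+`. -/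
def cubicRel (N : ℕ) : Set (NCPoly (Fin N × Fin N)) :=
  {r | ∃ i j k : Fin N, j ≠ k ∧ r = coord i j * coord i k} ∪
    {r | ∃ i j k : Fin N, j ≠ k ∧ r = coord j i * coord k i}

/-- The relations of `Ō_N`. -/
def twistedRel (N : ℕ) : Set (NCPoly (Fin N × Fin N)) :=
  {r | ∃ i j k l : Fin N, (i, j) ≠ (k, l) ∧ (i = k ∨ j = l) ∧
      r = coord i j * coord k l + coord k l * coord i j} ∪
    {r | ∃ i j k l : Fin N, ¬ ((i, j) ≠ (k, l) ∧ (i = k ∨ j = l)) ∧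
      r = coord i j * coord k l - coord k l * coord i j}

theorem freeHyperoctahedral_eq (N : ℕ) :
    freeHyperoctahedral N = subspaceOfFreeOrthogonal N (cubicRel N) := rfl

section

variable {N : ℕ}

theorem isCubic_iff {R : Type*} [Ring R] [Algebra ℂ R] (w : Fin N → Fin N → R) :
    IsCubic w ↔ ∀ r ∈ cubicRel N, NCPoly.evalHom (Function.uncurry w) r = 0 := by
  constructor
  · rintro h r (⟨i, j, k, hjk, rfl⟩ | ⟨i, j, k, hjk, rfl⟩)
    · simp [coord, h.row i j k hjk]
    · simp [coord, h.column i j k hjk]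
  · intro h
    refine ⟨fun i j k hjk => ?_, fun i j k hjk => ?_⟩
    · simpa [coord] using h _ (Or.inl ⟨i, j, k, hjk, rfl⟩)
    · simpa [coord] using h _ (Or.inr ⟨i, j, k, hjk, rfl⟩)

/-- The product of the row sign and the column sign is -1 exactly when the two entries differ and
share a row or a column. This merges the two families of relations into one multiplicative formula.
-/
theorem isTwisted_iff {R : Type*} [Ring R] [Algebra ℂ R] (w : Fin N → Fin N → R) :
    IsTwisted w ↔ ∀ r ∈ twistedRel N, NCPoly.evalHom (Function.uncurry w) r = 0 := by
  constructor
  · rintro h r (⟨i, j, k, l, hne, hor, rfl⟩ | ⟨i, j, k, l, hn, rfl⟩)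
    · have h1 := h i j k l
      have h2 : twistSign i k * twistSign j l = -1 := by
        rcases hor with rfl | rfl
        · rw [twistSign_self, twistSign_of_ne (fun e => hne (by rw [e])), one_mul]
        · rw [twistSign_self, twistSign_of_ne (fun e => hne (by rw [e])), mul_one]
      rw [h2, neg_one_smul] at h1
      simp [coord, h1]
    · have h1 := h i j k l
      have h2 : twistSign i k * twistSign j l = 1 := by
        by_cases hik : i = k
        · by_cases hjl : j = l
          · rw [hik, hjl, twistSign_self, twistSign_self, one_mul]
          · exact absurd ⟨fun e => hjl (Prod.ext_iff.1 e).2, Or.inl hik⟩ hn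
        · by_cases hjl : j = l
          · exact absurd ⟨fun e => hik (Prod.ext_iff.1 e).1, Or.inr hjl⟩ hn
          · rw [twistSign_of_ne hik, twistSign_of_ne hjl]; norm_num
      rw [h2, one_smul] at h1
      simp [coord, h1]
  · intro h i j k l
    by_cases hc : (i, j) ≠ (k, l) ∧ (i = k ∨ j = l)
    · have h1 := h _ (Or.inl ⟨i, j, k, l, hc.1, hc.2, rfl⟩)
      have h2 : twistSign i k * twistSign j l = -1 := by
        obtain ⟨hne, rfl | rfl⟩ := hc
        · rw [twistSign_self, twistSign_of_ne (fun e => hne (by rw [e])), one_mul]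
        · rw [twistSign_self, twistSign_of_ne (fun e => hne (by rw [e])), mul_one]
      rw [h2, neg_one_smul]
      simpa [coord, add_eq_zero_iff_eq_neg] using h1
    · have h1 := h _ (Or.inr ⟨i, j, k, l, hc, rfl⟩)
      by_cases hik : i = k
      · by_cases hjl : j = l
        · rw [hik, hjl, twistSign_self, twistSign_self, one_mul, one_smul]
        · exact absurd ⟨fun e => hjl (Prod.ext_iff.1 e).2, Or.inl hik⟩ hc
      · by_cases hjl : j = l
        · exact absurd ⟨fun e => hik (Prod.ext_iff.1 e).1, Or.inr hjl⟩ hc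
        · rw [twistSign_of_ne hik, twistSign_of_ne hjl, neg_mul_neg, one_mul, one_smul]
          simpa [coord, sub_eq_zero] using h1

theorem isCubic_gen (N : ℕ) : IsCubic (fun i j => (freeHyperoctahedral N).gen (i, j)) :=
  (isCubic_iff _).2 fun r hr => (freeHyperoctahedral N).evalHom_gen_rel r (Or.inr hr)

theorem isTwisted_gen (N : ℕ) : IsTwisted (fun i j => (twistedOrthogonal N).gen (i, j)) :=
  (isTwisted_iff _).2 fun r hr => (twistedOrthogonal N).evalHom_gen_rel r (Or.inr hr)

variable {A : Type u} [CStarAlgebra A] {B : Type v} [CStarAlgebra B]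

/-- The diagonal terms contain two distinct entries of one column of `w`, so only products of
distinct coordinates survive. -/
theorem IsCubic.tensorMulVec_mul {w : Fin N → Fin N → A} (hw : IsCubic w) (x y : Fin N → B)
    {i j : Fin N} (hij : i ≠ j) : tensorMulVec w x i * tensorMulVec w y j =
      ∑ k, ∑ l, if k = l then 0 else MinTensor.tmul (w i k * w j l) (x k * y l) := by
  rw [QIso.tensorMulVec_mul]
  refine Finset.sum_congr rfl fun k _ => Finset.sum_congr rfl fun l _ => ?_
  split_ifs with h
  · rw [h, hw.column l i j hij, MinTensor.zero_tmul]
  · rfl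

theorem IsCubic.tensorMul {w : Fin N → Fin N → A} {w' : Fin N → Fin N → B} (hw : IsCubic w)
    (hw' : IsCubic w') : IsCubic (tensorMul w w') where
  row i p q hpq := by
    rw [tensorMul_mul]
    refine Finset.sum_eq_zero fun k _ => Finset.sum_eq_zero fun l _ => ?_
    rcases eq_or_ne k l with rfl | hkl
    · rw [hw'.row k p q hpq, MinTensor.tmul_zero]
    · rw [hw.row i k l hkl, MinTensor.zero_tmul]
  column p i j hij := by
    rw [tensorMul_mul]
    refine Finset.sum_eq_zero fun k _ => Finset.sum_eq_zero fun l _ => ?_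
    rcases eq_or_ne k l with rfl | hkl
    · rw [hw.column k i j hij, MinTensor.zero_tmul]
    · rw [hw'.column p k l hkl, MinTensor.tmul_zero]

theorem isCubic_one {R : Type*} [Ring R] :
    IsCubic (fun i j : Fin N => if i = j then (1 : R) else 0) where
  row i j k hjk := by
    rcases eq_or_ne i j with rfl | h
    · rw [if_neg hjk, mul_zero]
    · rw [if_neg h, zero_mul]
  column i j k hjk := by
    rcases eq_or_ne j i with rfl | h
    · rw [if_neg hjk.symm, mul_zero]
    · rw [if_neg h, zero_mul]

theorem IsCubic.op_transpose {R : Type*} [Ring R] {w : Fin N → Fin N → R} (hw : IsCubic w) :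
    IsCubic (fun i j => MulOpposite.op (w j i)) where
  row i j k hjk := by rw [← MulOpposite.op_mul, hw.column i k j hjk.symm, MulOpposite.op_zero]
  column i j k hjk := by rw [← MulOpposite.op_mul, hw.row i k j hjk.symm, MulOpposite.op_zero]

theorem MinTensor.smul_tmul (c : ℂ) (a : A) (b : B) : tmul (c • a) b = c • tmul a b := by
  rw [tmul, ← TensorProduct.smul_tmul', map_smul, tmul]

theorem MinTensor.tmul_smul (c : ℂ) (a : A) (b : B) : tmul a (c • b) = c • tmul a b := by
  rw [tmul, TensorProduct.tmul_smul, map_smul, tmul]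

/-- Exchanging the factors from `w` costs the sign of (i, j) times the sign of (k, l), and
exchanging those from `x`, `y` costs `c` times the sign of (k, l). The latter sign squares to 1, so
the total no longer depends on the summation indices. For sphere coordinates `c = 1`; for columns p,
q of a second twisted matrix `c` is the sign of (p, q). -/
theorem IsTwisted.tensorMulVec_mul {w : Fin N → Fin N → A} (hw : IsTwisted w) {x y : Fin N → B}
    {c : ℂ} (hxy : ∀ k l, x k * y l = (c * twistSign k l) • (y l * x k)) (i j : Fin N) :
    tensorMulVec w x i * tensorMulVec w y j =
      (twistSign i j * c) • (tensorMulVec w y j * tensorMulVec w x i) := by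
  rw [QIso.tensorMulVec_mul, QIso.tensorMulVec_mul, Finset.sum_comm, Finset.smul_sum]
  refine Finset.sum_congr rfl fun l _ => ?_
  rw [Finset.smul_sum]
  refine Finset.sum_congr rfl fun k _ => ?_
  rw [hw i k j l, hxy k l, MinTensor.smul_tmul, MinTensor.tmul_smul, smul_smul]
  congr 1
  linear_combination twistSign i j * c * twistSign_mul_self k l

theorem IsTwisted.tensorMul {w : Fin N → Fin N → A} {w' : Fin N → Fin N → B} (hw : IsTwisted w)
    (hw' : IsTwisted w') : IsTwisted (tensorMul w w') := fun i p j q =>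
  hw.tensorMulVec_mul (fun k l => by rw [hw' k p l q, mul_comm (twistSign k l)]) i j

theorem isTwisted_one {R : Type*} [CommRing R] [Algebra ℂ R] :
    IsTwisted (fun i j : Fin N => if i = j then (1 : R) else 0) := by
  intro i j k l
  dsimp only
  by_cases h1 : i = j
  · by_cases h2 : k = l
    · rw [← h1, ← h2, twistSign_mul_self, one_smul, mul_comm]
    · rw [if_neg h2, mul_zero, zero_mul, smul_zero]
  · rw [if_neg h1, mul_zero, zero_mul, smul_zero]

theorem IsTwisted.op_transpose {R : Type*} [Ring R] [Algebra ℂ R] {w : Fin N → Fin N → R}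
    (hw : IsTwisted w) : IsTwisted (fun i j => MulOpposite.op (w j i)) := by
  intro i j k l
  rw [← MulOpposite.op_mul, ← MulOpposite.op_mul, ← MulOpposite.op_smul, hw l k j i,
    twistSign_comm l j, twistSign_comm k i, mul_comm (twistSign j l)]

theorem isQuantumGroup_freeHyperoctahedral (N : ℕ) :
    IsQuantumGroup (fun i j => (freeHyperoctahedral N).gen (i, j)) :=
  isQuantumGroup_gen (cubicRel N)
    ((isCubic_iff _).1 ((isCubic_gen N).tensorMul (isCubic_gen N)))
    ((isCubic_iff _).1 isCubic_one) ((isCubic_iff _).1 (isCubic_gen N).op_transpose)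

theorem isQuantumGroup_twistedOrthogonal (N : ℕ) :
    IsQuantumGroup (fun i j => (twistedOrthogonal N).gen (i, j)) :=
  isQuantumGroup_gen (twistedRel N)
    ((isTwisted_iff _).1 ((isTwisted_gen N).tensorMul (isTwisted_gen N)))
    ((isTwisted_iff _).1 isTwisted_one) ((isTwisted_iff _).1 (isTwisted_gen N).op_transpose)

/-! ### The actions on the spheres -/

theorem IsSpherePoint.mul_eq {R : Type*} [Ring R] [Algebra ℂ R] {d : ℕ} {x : Fin N → R}
    (hx : IsSpherePoint d x) (i j : Fin N) : x i * x j = twistSign i j • (x j * x i) := by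
  rcases eq_or_ne i j with rfl | h
  · rw [twistSign_self, one_smul]
  · rw [twistSign_of_ne h, neg_one_smul, ← add_eq_zero_iff_eq_neg, hx.anticomm i j h]

theorem IsSpherePoint.mul_eq_zero {R : Type*} [Ring R] {x : Fin N → R} (hx : IsSpherePoint 1 x)
    {i j : Fin N} (h : i ≠ j) : x i * x j = 0 := by
  have h1 := hx.prod ![i, j] (by
    intro a b; fin_cases a <;> fin_cases b <;> simp [h, h.symm])
  simpa using h1

theorem IsSpherePoint.mul_mul_eq_zero {R : Type*} [Ring R] {x : Fin N → R}
    (hx : IsSpherePoint 2 x) {i j k : Fin N} (hij : i ≠ j) (hik : i ≠ k) (hjk : j ≠ k) :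
    x i * x j * x k = 0 := by
  have h1 := hx.prod ![i, j, k] (by
    intro a b; fin_cases a <;> fin_cases b <;> simp [hij, hij.symm, hik, hik.symm, hjk, hjk.symm])
  simpa [mul_assoc] using h1

theorem IsTwisted.anticomm_tensorMulVec {w : Fin N → Fin N → A} (hw : IsTwisted w) {d : ℕ}
    {x : Fin N → B} (hx : IsSpherePoint d x) (i j : Fin N) (hij : i ≠ j) :
    tensorMulVec w x i * tensorMulVec w x j + tensorMulVec w x j * tensorMulVec w x i = 0 := by
  rw [hw.tensorMulVec_mul (c := 1) (fun k l => by rw [one_mul, hx.mul_eq k l]) i j,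
    twistSign_of_ne hij, mul_one, neg_one_smul, neg_add_cancel]

theorem actsAffinely_freeHyperoctahedral (N : ℕ) :
    ActsAffinely (fun i j => (freeHyperoctahedral N).gen (i, j)) (twistedPolygonalSphere N 1) := by
  rw [freeHyperoctahedral_eq]
  have hc : IsCubic (fun i j => (subspaceOfFreeOrthogonal N (cubicRel N)).gen (i, j)) :=
    isCubic_gen N
  have h : ∀ i j, i ≠ j →
      tensorMulVec (fun i j => (subspaceOfFreeOrthogonal N (cubicRel N)).gen (i, j))
        (twistedPolygonalSphere N 1).gen i *
      tensorMulVec (fun i j => (subspaceOfFreeOrthogonal N (cubicRel N)).gen (i, j))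
        (twistedPolygonalSphere N 1).gen j = 0 := by
    intro i j hij
    rw [hc.tensorMulVec_mul _ _ hij]
    refine Finset.sum_eq_zero fun k _ => Finset.sum_eq_zero fun l _ => ?_
    split_ifs with hkl
    · rfl
    · rw [(isSpherePoint_gen 1).mul_eq_zero hkl, MinTensor.tmul_zero]
  refine (isOrthogonal_gen (cubicRel N)).actsAffinely (fun i j hij => ?_) (fun f hf => ?_)
  · rw [h i j hij, h j i hij.symm, add_zero]
  · simpa using h (f 0) (f 1) (hf.ne (by decide))

theorem actsAffinely_twistedOrthogonal (N : ℕ) :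
    ActsAffinely (fun i j => (twistedOrthogonal N).gen (i, j)) (twistedPolygonalSphere N N) :=
  (isOrthogonal_gen (twistedRel N)).actsAffinely
    ((isTwisted_gen N).anticomm_tensorMulVec (isSpherePoint_gen N))
    -- At d = N the product relations are vacuous: there are no N + 1 distinct indices.
    (fun f hf => absurd (Fintype.card_le_of_injective f hf) (by simp))

/-! ### Matrix points of the spheres -/

/-- The coordinate points `e_m`. -/
theorem isSpherePoint_single {d : ℕ} (hd : 1 ≤ d) (m : Fin N) : IsSpherePoint d
    (fun i => if i = m then (1 : Matrix (Fin 1) (Fin 1) ℂ) else 0) where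
  sum := by simp
  anticomm i j hij := by
    rcases eq_or_ne i m with rfl | h
    · rw [if_neg hij.symm, mul_zero, zero_mul, add_zero]
    · rw [if_neg h, mul_zero, zero_mul, add_zero]
  prod f hf := by
    have hne : ∃ k, f k ≠ m := by
      by_contra! hc
      have h := hf ((hc 0).trans (hc (Fin.last d)).symm)
      have := congrArg Fin.val h
      simp at this
      omega
    obtain ⟨k, hk⟩ := hne
    exact List.prod_eq_zero (List.mem_ofFn.2 ⟨k, if_neg hk⟩)

/-- The points with two noncommuting coordinates, given by multiples of Pauli matrices. -/
def pauliPoint (a b i : Fin N) : Matrix (Fin 2) (Fin 2) ℂ :=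
  if i = a then !![0, 3 / 5; 3 / 5, 0] else if i = b then !![4 / 5, 0; 0, -(4 / 5)] else 0

theorem star_pauliPoint (a b i : Fin N) : star (pauliPoint a b i) = pauliPoint a b i := by
  unfold pauliPoint
  split_ifs
  · ext p q; fin_cases p <;> fin_cases q <;> simp [Matrix.star_apply]
  · ext p q; fin_cases p <;> fin_cases q <;> simp [Matrix.star_apply]
  · exact star_zero _

/-- The two Pauli matrices anticommute and square to 1, and `(3/5)² + (4/5)² = 1` with both weights
nonzero. At most two coordinates are nonzero, so a product of d + 1 ≥ 3 distinct ones has a zero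
factor. -/
theorem isSpherePoint_pauliPoint {d : ℕ} (hd : 2 ≤ d) {a b : Fin N} (hab : a ≠ b) :
    IsSpherePoint d (pauliPoint a b) where
  sum := by
    have h : ∀ i, pauliPoint a b i * pauliPoint a b i =
        (if i = a then (9 / 25 : ℂ) • (1 : Matrix (Fin 2) (Fin 2) ℂ) else 0) +
          if i = b then (16 / 25 : ℂ) • (1 : Matrix (Fin 2) (Fin 2) ℂ) else 0 := by
      intro i
      unfold pauliPoint
      split_ifs with h1 h2 h2
      · exact absurd (h1.symm.trans h2) hab
      all_goals
        ext p q; fin_cases p <;> fin_cases q <;> simp [Matrix.mul_apply] <;> norm_num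
    simp only [h, Finset.sum_add_distrib, Finset.sum_ite_eq', Finset.mem_univ, if_true]
    rw [← add_smul]
    norm_num
  anticomm i j hij := by
    unfold pauliPoint
    split_ifs with h1 h2 h2 h2 h3
    · exact absurd (h1.trans h2.symm) hij
    all_goals first
      | (exfalso; apply hij; simp_all; done)
      | (ext p q; fin_cases p <;> fin_cases q <;> simp <;> ring)
  prod f hf := by
    have hne : ∃ k, f k ≠ a ∧ f k ≠ b := by
      by_contra! hc
      have h : Finset.univ.image f ⊆ {a, b} := by
        intro i hi
        obtain ⟨k, -, rfl⟩ := Finset.mem_image.1 hi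
        rw [Finset.mem_insert, Finset.mem_singleton]
        exact or_iff_not_imp_left.2 (hc k)
      have h' := Finset.card_le_card h
      rw [Finset.card_image_of_injective _ hf, Finset.card_fin, Finset.card_pair hab] at h'
      omega
    obtain ⟨k, hk⟩ := hne
    exact List.prod_eq_zero (List.mem_ofFn.2 ⟨k, by simp [pauliPoint, hk.1, hk.2]⟩)

/-! ### Relations forced on `w` by an affine action -/

section Action

variable {w : Fin N → Fin N → A} {d : ℕ} (hw : ActsAffinely w (twistedPolygonalSphere N d))
include hw

/-- The columns of the matrix of an affine action are points of the sphere. -/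
theorem ActsAffinely.isSpherePoint_column (hd : 1 ≤ d) (m : Fin N) :
    IsSpherePoint d (fun i => w i m) := by
  have h := hw.isSpherePoint (fun i => by split_ifs <;> simp) (isSpherePoint_single hd m)
  let e : Matrix (Fin 1) (Fin 1) A →+* A :=
    { toFun := fun a => a 0 0
      map_one' := by simp
      map_mul' := fun a b => by simp [Matrix.mul_apply]
      map_zero' := rfl
      map_add' := fun a b => rfl }
  have he : ∀ i, e (Matrix.of fun p q => ∑ j, (if j = m then (1 : Matrix (Fin 1) (Fin 1) ℂ)
      else 0) p q • w i j) = w i m := by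
    intro i
    change ∑ j, (if j = m then (1 : Matrix (Fin 1) (Fin 1) ℂ) else 0) 0 0 • w i j = w i m
    rw [Finset.sum_eq_single m (fun j _ hj => by simp [hj]) (by simp)]
    simp
  refine ⟨?_, fun i j hij => ?_, fun f hf => ?_⟩
  · have := congrArg e h.sum
    simpa only [map_sum, map_mul, he, map_one] using this
  · have := congrArg e (h.anticomm i j hij)
    simpa only [map_add, map_mul, he, map_zero] using this
  · have := congrArg e (h.prod f hf)
    rw [map_list_prod, List.map_ofFn, map_zero] at this
    simpa only [Function.comp_def, he] using this

/-- This is the image of a Pauli point under the action: only columns a and b of `w` contribute. -/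
theorem ActsAffinely.isSpherePoint_pauli (hd : 2 ≤ d) {a b : Fin N} (hab : a ≠ b) :
    IsSpherePoint d (fun i => !![(4 / 5 : ℂ) • w i b, (3 / 5 : ℂ) • w i a;
      (3 / 5 : ℂ) • w i a, -((4 / 5 : ℂ) • w i b)]) := by
  have h := hw.isSpherePoint (star_pauliPoint a b) (isSpherePoint_pauliPoint hd hab)
  have he : ∀ i, (Matrix.of fun p q => ∑ j, pauliPoint a b j p q • w i j : Matrix (Fin 2) (Fin 2) A)
      = !![(4 / 5 : ℂ) • w i b, (3 / 5 : ℂ) • w i a;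
        (3 / 5 : ℂ) • w i a, -((4 / 5 : ℂ) • w i b)] := by
    intro i
    have h1 : ∀ (p q : Fin 2), ∑ j, pauliPoint a b j p q • w i j =
        pauliPoint a b a p q • w i a + pauliPoint a b b p q • w i b := by
      intro p q
      rw [← Finset.sum_pair (f := fun j => pauliPoint a b j p q • w i j) hab]
      refine (Finset.sum_subset (Finset.subset_univ _) fun j _ hj => ?_).symm
      rw [Finset.mem_insert, Finset.mem_singleton, not_or] at hj
      simp [pauliPoint, hj.1, hj.2]
    ext p q
    rw [Matrix.of_apply, h1]
    fin_cases p <;> fin_cases q <;> simp [pauliPoint, hab.symm]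
  simpa only [he] using h

/-- This is the off-diagonal entry of the anticommutation relation at a Pauli point, divided by
`12/25 = (3/5)(4/5)`. -/
theorem ActsAffinely.commutator_eq (hd : 2 ≤ d) {i j a b : Fin N} (hij : i ≠ j) (hab : a ≠ b) :
    w i a * w j b - w j b * w i a = w i b * w j a - w j a * w i b := by
  have h := congrFun (congrFun ((hw.isSpherePoint_pauli hd hab).anticomm i j hij) 0) 1
  simp only [Matrix.add_apply, Matrix.mul_apply, Fin.sum_univ_two, Matrix.zero_apply] at h
  simp only [Matrix.of_apply, Matrix.cons_val', Matrix.cons_val_zero, Matrix.cons_val_one,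
    Matrix.cons_val_fin_one, smul_mul_smul_comm, mul_neg] at h
  have h2 : (12 / 25 : ℂ) •
      (w i b * w j a - w i a * w j b + w j b * w i a - w j a * w i b) = 0 := by
    rw [← h]
    simp only [smul_sub, smul_add]
    norm_num
    abel
  have h3 := (smul_eq_zero.1 h2).resolve_left (by norm_num)
  rw [← sub_eq_zero, ← neg_eq_zero, ← h3]
  abel

/-- Columns anticommute by the coordinate points and rows by the antipode. For entries in different
rows and columns, the commutator identity and its image under the antipode differ by a sign, so both
sides are zero. -/
theorem ActsAffinely.isTwisted (hd : 2 ≤ d) (hq : IsQuantumGroup w) : IsTwisted w := by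
  have col : ∀ a i j, i ≠ j → w i a * w j a + w j a * w i a = 0 := fun a =>
    (hw.isSpherePoint_column (by omega) a).anticomm
  have row : ∀ a i j, i ≠ j → w a i * w a j + w a j * w a i = 0 := by
    intro a i j hij
    have h := hq.evalHom_op_transpose (coord i a * coord j a + coord j a * coord i a)
      (by simpa [coord] using col a i j hij)
    simpa [coord, ← MulOpposite.op_mul, ← MulOpposite.op_add, add_comm] using h
  have comm : ∀ i j a b, i ≠ j → a ≠ b → w i a * w j b = w j b * w i a := by
    intro i j a b hij hab
    have h1 := hw.commutator_eq hd hij hab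
    -- The identity is used with the roles of rows and columns exchanged; the antipode transposes it
    -- back, and the reversal of products changes the sign of one side relative to `h1`.
    have h2 := hq.evalHom_op_transpose (coord a i * coord b j - coord b j * coord a i -
        (coord a j * coord b i - coord b i * coord a j))
      (by simpa [coord, sub_eq_zero] using hw.commutator_eq hd hab hij)
    simp only [coord, map_sub, map_mul, NCPoly.evalHom_X, ← MulOpposite.op_mul,
      ← MulOpposite.op_sub, MulOpposite.op_eq_zero_iff] at h2
    have h3 : (2 : ℂ) • (w i a * w j b - w j b * w i a) = 0 := by
      rw [two_smul]
      nth_rewrite 1 [h1]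
      rw [← neg_eq_zero, ← h2]
      abel
    exact sub_eq_zero.1 ((smul_eq_zero.1 h3).resolve_left (by norm_num))
  intro i a j b
  rcases eq_or_ne i j with rfl | hij
  · rcases eq_or_ne a b with rfl | hab
    · rw [twistSign_self, twistSign_self, one_mul, one_smul]
    · rw [twistSign_self, twistSign_of_ne hab, one_mul, neg_one_smul, ← add_eq_zero_iff_eq_neg,
        row i a b hab]
  · rcases eq_or_ne a b with rfl | hab
    · rw [twistSign_self, twistSign_of_ne hij, mul_one, neg_one_smul, ← add_eq_zero_iff_eq_neg,
        col a i j hij]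
    · rw [twistSign_of_ne hij, twistSign_of_ne hab, neg_mul_neg, one_mul, one_smul,
        comm i j a b hij hab]

omit hw in
/-- If the products of distinct entries on the same column vanish, so do those on the same row. -/
theorem IsQuantumGroup.isCubic (hq : IsQuantumGroup w)
    (col : ∀ a i j, i ≠ j → w i a * w j a = 0) : IsCubic w where
  column := col
  row a i j hij := by
    have h := hq.evalHom_op_transpose (coord j a * coord i a)
      (by simpa [coord] using col a j i hij.symm)
    simpa [coord, ← MulOpposite.op_mul] using h

end Action

/-! ### The isometry groups at d = 1 and d = N -/

theorem isQuantumIsometryGroup_freeHyperoctahedral (N : ℕ) :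
    IsQuantumIsometryGroup.{0, v} (fun i j => (freeHyperoctahedral N).gen (i, j))
      (twistedPolygonalSphere N 1) where
  isQuantumGroup := isQuantumGroup_freeHyperoctahedral N
  actsAffinely := actsAffinely_freeHyperoctahedral N
  universal _ _ _ hq hw := hq.isOrthogonal.exists_lift ((isCubic_iff _).1
    (hq.isCubic fun a _ _ hij => (hw.isSpherePoint_column le_rfl a).mul_eq_zero hij))

theorem IsQuantumGroup.isTwisted_of_actsAffinely {w : Fin N → Fin N → A} (hq : IsQuantumGroup w)
    (hw : ActsAffinely w (twistedPolygonalSphere N N)) : IsTwisted w := by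
  rcases lt_or_ge N 2 with hN | hN
  · have : Subsingleton (Fin N) := Fin.subsingleton_iff_le_one.2 (by omega)
    intro i j k l
    rw [Subsingleton.elim k i, Subsingleton.elim l j, twistSign_self, twistSign_self, one_mul,
      one_smul]
  · exact hw.isTwisted hN hq

theorem isQuantumIsometryGroup_twistedOrthogonal (N : ℕ) :
    IsQuantumIsometryGroup.{0, v} (fun i j => (twistedOrthogonal N).gen (i, j))
      (twistedPolygonalSphere N N) where
  isQuantumGroup := isQuantumGroup_twistedOrthogonal N
  actsAffinely := actsAffinely_twistedOrthogonal N
  universal _ _ _ hq hw := hq.isOrthogonal.exists_lift ((isTwisted_iff _).1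
    (hq.isTwisted_of_actsAffinely hw))

end

/-! ### The hyperoctahedral group -/

section

variable {N : ℕ}

theorem isOrthogonal_signedPermMatrix (σ : Equiv.Perm (Fin N)) (s : Fin N → ℤˣ) :
    IsOrthogonal (signedPermMatrix σ s) where
  selfAdjoint i j := rfl
  row i j := by
    have hs : ∀ k, ((s k : ℤ) : ℝ) * ((s k : ℤ) : ℝ) = 1 := fun k => by
      rcases Int.units_eq_one_or (s k) with h | h <;> simp [h]
    rw [Finset.sum_eq_single (σ.symm i)]
    · simp only [signedPermMatrix, Matrix.of_apply, Equiv.apply_symm_apply, if_true, mul_ite,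
        mul_zero, hs, eq_comm]
    · intro k _ hk
      have : i ≠ σ k := fun h => hk (by rw [h, Equiv.symm_apply_apply])
      simp [signedPermMatrix, this]
    · simp
  column i j := by
    have hs : ∀ k, ((s k : ℤ) : ℝ) * ((s k : ℤ) : ℝ) = 1 := fun k => by
      rcases Int.units_eq_one_or (s k) with h | h <;> simp [h]
    rw [Finset.sum_eq_single (σ i)]
    · rcases eq_or_ne i j with rfl | hij
      · simp [signedPermMatrix, hs]
      · simp [signedPermMatrix, hij]
    · intro k _ hk
      simp [signedPermMatrix, hk]
    · simp

theorem isCubic_signedPermMatrix (σ : Equiv.Perm (Fin N)) (s : Fin N → ℤˣ) :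
    IsCubic (signedPermMatrix σ s) where
  row i j k hjk := by
    by_cases h : i = σ j
    · have : i ≠ σ k := fun h' => hjk (σ.injective (h.symm.trans h'))
      simp [signedPermMatrix, this]
    · simp [signedPermMatrix, h]
  column i j k hjk := by
    by_cases h : j = σ i
    · have : k ≠ σ i := fun h' => hjk (h.trans h'.symm)
      simp [signedPermMatrix, this]
    · simp [signedPermMatrix, h]

/-- Orthogonal matrices with at most one nonzero entry on each row and column are signed
permutation matrices. -/
theorem mem_hyperoctahedral {m : Matrix (Fin N) (Fin N) ℝ} (hm : IsOrthogonal m)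
    (hc : IsCubic m) : m ∈ hyperoctahedral N := by
  -- Each column has norm one, hence a nonzero entry; the column relations make it unique, and the
  -- row relations make its position injective in j.
  have hex : ∀ j, ∃ i, m i j ≠ 0 := by
    intro j
    by_contra! h
    have := hm.column j j
    simp [h] at this
  choose σ hσ using hex
  have hzero : ∀ i j, i ≠ σ j → m i j = 0 := fun i j hij =>
    (mul_eq_zero.1 (hc.column j i (σ j) hij)).resolve_right (hσ j)
  have hinj : Function.Injective σ := by
    intro j k h
    by_contra hjk
    have h1 := hc.row (σ j) j k hjk
    rcases mul_eq_zero.1 h1 with h2 | h2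
    · exact hσ j h2
    · rw [h] at h2; exact hσ k h2
  have hsq : ∀ j, m (σ j) j * m (σ j) j = 1 := by
    intro j
    have h1 := hm.column j j
    rwa [if_pos rfl, Finset.sum_eq_single (σ j) (fun i _ hi => by rw [hzero i j hi, mul_zero])
      (by simp)] at h1
  refine ⟨(Equiv.ofBijective σ (Finite.injective_iff_bijective.1 hinj),
    fun j => if m (σ j) j = 1 then 1 else -1), ?_⟩
  ext i j
  simp only [signedPermMatrix, Matrix.of_apply, Equiv.ofBijective_apply]
  split_ifs with h1 h2
  · rw [h1, h2]; simp
  · rw [h1, (mul_self_eq_one_iff.1 (hsq j)).resolve_left h2]; simp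
  · exact (hzero i j h1).symm

/-! ### The coordinate functions on H_N and their universal property -/

theorem isOrthogonal_hyperoctahedralCoord (N : ℕ) :
    IsOrthogonal (fun i j : Fin N => hyperoctahedralCoord i j) where
  selfAdjoint i j := by
    ext g
    exact Complex.conj_ofReal _
  row i j := by
    ext ⟨_, ⟨σ, s⟩, rfl⟩
    have h := congrArg (fun x : ℝ => (x : ℂ)) ((isOrthogonal_signedPermMatrix σ s).row i j)
    rw [ContinuousMap.sum_apply]
    simp only [Complex.ofReal_sum, Complex.ofReal_mul] at h
    refine h.trans ?_
    split_ifs <;> simp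
  column i j := by
    ext ⟨_, ⟨σ, s⟩, rfl⟩
    have h := congrArg (fun x : ℝ => (x : ℂ)) ((isOrthogonal_signedPermMatrix σ s).column i j)
    rw [ContinuousMap.sum_apply]
    simp only [Complex.ofReal_sum, Complex.ofReal_mul] at h
    refine h.trans ?_
    split_ifs <;> simp

theorem isCubic_hyperoctahedralCoord (N : ℕ) :
    IsCubic (fun i j : Fin N => hyperoctahedralCoord i j) where
  row i j k hjk := by
    ext ⟨_, ⟨σ, s⟩, rfl⟩
    have h := congrArg (fun x : ℝ => (x : ℂ)) ((isCubic_signedPermMatrix σ s).row i j k hjk)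
    exact ((Complex.ofReal_mul _ _).symm.trans h).trans Complex.ofReal_zero
  column i j k hjk := by
    ext ⟨_, ⟨σ, s⟩, rfl⟩
    have h := congrArg (fun x : ℝ => (x : ℂ)) ((isCubic_signedPermMatrix σ s).column i j k hjk)
    exact ((Complex.ofReal_mul _ _).symm.trans h).trans Complex.ofReal_zero

theorem adjoin_hyperoctahedralCoord (N : ℕ) :
    (StarAlgebra.adjoin ℂ (Set.range (Function.uncurry fun i j : Fin N =>
      hyperoctahedralCoord i j))).topologicalClosure = ⊤ := by
  refine ContinuousMap.starSubalgebra_topologicalClosure_eq_top_of_separatesPoints _ ?_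
  intro g g' hne
  have : ∃ i j, g.1 i j ≠ g'.1 i j := by
    by_contra! h
    exact hne (Subtype.ext (Matrix.ext h))
  obtain ⟨i, j, hij⟩ := this
  exact ⟨_, ⟨hyperoctahedralCoord i j, StarAlgebra.subset_adjoin ℂ _ ⟨(i, j), rfl⟩, rfl⟩,
    fun h => hij (Complex.ofReal_injective h)⟩

/-- A character of `C` turns `z` into a real orthogonal matrix with the cubic relations, that is, a
point of H_N. This defines a continuous map from the spectrum of `C` to H_N, and the required
morphism is its pullback followed by the inverse Gelfand transform. -/
theorem exists_hyperoctahedral_lift_of_comm {C : Type v} [CommCStarAlgebra C]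
    {z : Fin N → Fin N → C} (hz : IsOrthogonal z) (hc : IsCubic z) :
    ∃ θ : C(hyperoctahedral N, ℂ) →⋆ₐ[ℂ] C, ∀ i j, θ (hyperoctahedralCoord i j) = z i j := by
  have hreal : ∀ (φ : WeakDual.characterSpace ℂ C) i j, (((φ (z i j)).re : ℝ) : ℂ) = φ (z i j) := by
    intro φ i j
    refine Complex.conj_eq_iff_re.1 ?_
    have h := map_star φ (z i j)
    rw [hz.selfAdjoint] at h
    exact h.symm
  have hmem : ∀ φ : WeakDual.characterSpace ℂ C,
      (Matrix.of fun i j => (φ (z i j)).re) ∈ hyperoctahedral N := by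
    intro φ
    refine mem_hyperoctahedral ⟨fun i j => rfl, fun i j => ?_, fun i j => ?_⟩
      ⟨fun i j k hjk => ?_, fun i j k hjk => ?_⟩ <;> apply Complex.ofReal_injective
    · simp only [Matrix.of_apply, Complex.ofReal_sum, Complex.ofReal_mul, hreal, ← map_mul,
        ← map_sum, hz.row]
      split_ifs <;> simp
    · simp only [Matrix.of_apply, Complex.ofReal_sum, Complex.ofReal_mul, hreal, ← map_mul,
        ← map_sum, hz.column]
      split_ifs <;> simp
    · simp only [Matrix.of_apply, Complex.ofReal_mul, hreal, ← map_mul, hc.row i j k hjk,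
        map_zero, Complex.ofReal_zero]
    · simp only [Matrix.of_apply, Complex.ofReal_mul, hreal, ← map_mul, hc.column i j k hjk,
        map_zero, Complex.ofReal_zero]
  have hcont : Continuous fun φ : WeakDual.characterSpace ℂ C =>
      (⟨_, hmem φ⟩ : hyperoctahedral N) := by
    refine Continuous.subtype_mk (continuous_pi fun i => continuous_pi fun j => ?_) _
    exact Complex.continuous_re.comp
      ((WeakDual.eval_continuous (z i j)).comp continuous_subtype_val)
  let e := gelfandStarTransform C
  refine ⟨(StarAlgHomClass.toStarAlgHom e.symm).comp
    (ContinuousMap.compStarAlgHom' ℂ ℂ ⟨_, hcont⟩), fun i j => ?_⟩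
  change e.symm _ = _
  rw [← e.symm_apply_apply (z i j)]
  congr 1
  ext φ
  exact hreal φ i j

/-- The universal property of the algebra of functions on the hyperoctahedral group. -/
theorem exists_hyperoctahedral_lift {C : Type v} [CStarAlgebra C] {z : Fin N → Fin N → C}
    (hz : IsOrthogonal z) (hc : IsCubic z) (comm : ∀ i j k l, z i j * z k l = z k l * z i j) :
    ∃ θ : C(hyperoctahedral N, ℂ) →⋆ₐ[ℂ] C, ∀ i j, θ (hyperoctahedralCoord i j) = z i j := by
  have hadj : IsMulCommutative (StarAlgebra.adjoin ℂ (Set.range (Function.uncurry z))) := by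
    refine StarAlgebra.isMulCommutative_adjoin ℂ ?_ ?_
    · rintro _ ⟨⟨i, j⟩, rfl⟩ _ ⟨⟨k, l⟩, rfl⟩
      exact comm i j k l
    · rintro _ ⟨⟨i, j⟩, rfl⟩ _ ⟨⟨k, l⟩, rfl⟩
      rw [Function.uncurry_apply_pair, Function.uncurry_apply_pair, hz.selfAdjoint]
      exact comm i j k l
  -- The closed *-subalgebra generated by the commuting entries is a commutative C*-algebra, to
  -- which Gelfand duality applies.
  let S := (StarAlgebra.adjoin ℂ (Set.range (Function.uncurry z))).topologicalClosure
  have hS : IsClosed (S : Set C) := StarSubalgebra.isClosed_topologicalClosure _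
  let _ : CommCStarAlgebra S :=
    { StarSubalgebra.cstarAlgebra S with
      mul_comm := (StarSubalgebra.commRingTopologicalClosure
        (StarAlgebra.adjoin ℂ (Set.range (Function.uncurry z))) fun a b => mul_comm' a b).mul_comm }
  let z' : Fin N → Fin N → S := fun i j => ⟨z i j, StarSubalgebra.le_topologicalClosure _
    (StarAlgebra.subset_adjoin ℂ _ ⟨(i, j), rfl⟩)⟩
  have hinj : Function.Injective (StarSubalgebra.subtype S) := Subtype.val_injective
  have hval : ∀ i j, StarSubalgebra.subtype S (z' i j) = z i j := fun _ _ => rfl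
  obtain ⟨θ, hθ⟩ := exists_hyperoctahedral_lift_of_comm (z := z')
    ⟨fun i j => hinj (hz.selfAdjoint i j),
      fun i j => hinj (by
        rw [map_sum]; simp only [map_mul, hval, hz.row]; split_ifs <;> simp),
      fun i j => hinj (by
        rw [map_sum]; simp only [map_mul, hval, hz.column]; split_ifs <;> simp)⟩
    ⟨fun i j k hjk => hinj (hc.row i j k hjk), fun i j k hjk => hinj (hc.column i j k hjk)⟩
  exact ⟨(StarSubalgebra.subtype S).comp θ, fun i j => congrArg (StarSubalgebra.subtype S) (hθ i j)⟩

variable {A : Type u} [CStarAlgebra A] {B : Type v} [CStarAlgebra B]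

theorem tensorMul_comm {w : Fin N → Fin N → A} {w' : Fin N → Fin N → B}
    (hw : ∀ i j k l, w i j * w k l = w k l * w i j)
    (hw' : ∀ i j k l, w' i j * w' k l = w' k l * w' i j) (i p j q : Fin N) :
    tensorMul w w' i p * tensorMul w w' j q = tensorMul w w' j q * tensorMul w w' i p := by
  rw [tensorMul_mul, tensorMul_mul, Finset.sum_comm]
  refine Finset.sum_congr rfl fun l _ => Finset.sum_congr rfl fun k _ => ?_
  rw [hw, hw']

theorem isQuantumGroup_hyperoctahedral (N : ℕ) :
    IsQuantumGroup (fun i j : Fin N => hyperoctahedralCoord i j) :=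
  have ho := isOrthogonal_hyperoctahedralCoord N
  have hc := isCubic_hyperoctahedralCoord N
  ho.isQuantumGroup (adjoin_hyperoctahedralCoord N)
    (exists_hyperoctahedral_lift (ho.tensorMul ho) (hc.tensorMul hc)
      (tensorMul_comm (fun _ _ _ _ => mul_comm _ _) (fun _ _ _ _ => mul_comm _ _)))
    (exists_hyperoctahedral_lift isOrthogonal_one isCubic_one fun _ _ _ _ => mul_comm _ _)
    (exists_hyperoctahedral_lift ho.op_transpose hc.op_transpose fun _ _ _ _ => mul_comm _ _)

/-- Wherever the twist asks for a minus sign, both products are zero, so the sign does not matter.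
-/
theorem IsCubic.isTwisted_of_comm {R : Type*} [Ring R] [Algebra ℂ R] {w : Fin N → Fin N → R}
    (hw : IsCubic w) (comm : ∀ i j k l, w i j * w k l = w k l * w i j) : IsTwisted w := by
  intro i j k l
  rcases eq_or_ne i k with rfl | hik
  · rcases eq_or_ne j l with rfl | hjl
    · rw [twistSign_self, twistSign_self, one_mul, one_smul]
    · rw [hw.row i j l hjl, hw.row i l j hjl.symm, smul_zero]
  · rcases eq_or_ne j l with rfl | hjl
    · rw [hw.column j i k hik, hw.column j k i hik.symm, smul_zero]
    · rw [twistSign_of_ne hik, twistSign_of_ne hjl, neg_mul_neg, one_mul, one_smul, comm]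

theorem IsTwisted.comm {R : Type*} [Ring R] [Algebra ℂ R] {w : Fin N → Fin N → R}
    (hw : IsTwisted w) {i j k l : Fin N} (hik : i ≠ k) (hjl : j ≠ l) :
    w i j * w k l = w k l * w i j := by
  rw [hw i j k l, twistSign_of_ne hik, twistSign_of_ne hjl, neg_mul_neg, one_mul, one_smul]

/-- The two sets of relations together force commutativity: products within a row or column vanish,
and all other pairs commute by the twist. This is how the classical group appears at d = 2. -/
theorem IsCubic.comm {R : Type*} [Ring R] [Algebra ℂ R] {w : Fin N → Fin N → R}
    (hw : IsCubic w) (ht : IsTwisted w) (i j k l : Fin N) :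
    w i j * w k l = w k l * w i j := by
  rcases eq_or_ne i k with rfl | hik
  · rcases eq_or_ne j l with rfl | hjl
    · rfl
    · rw [hw.row i j l hjl, hw.row i l j hjl.symm]
  · rcases eq_or_ne j l with rfl | hjl
    · rw [hw.column j i k hik, hw.column j k i hik.symm]
    · exact ht.comm hik hjl

/-- In the expansion of a triple product, either two column indices coincide and the coefficient in
C(H_N) vanishes, or all three are distinct and the product of sphere coordinates vanishes. -/
theorem actsAffinely_hyperoctahedral (N : ℕ) :
    ActsAffinely (fun i j : Fin N => hyperoctahedralCoord i j) (twistedPolygonalSphere N 2) := by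
  have hc := isCubic_hyperoctahedralCoord N
  refine (isOrthogonal_hyperoctahedralCoord N).actsAffinely
    ((hc.isTwisted_of_comm fun _ _ _ _ => mul_comm _ _).anticomm_tensorMulVec (isSpherePoint_gen 2))
    fun f hf => ?_
  have h3 : ∀ (w : Fin N → Fin N → C(hyperoctahedral N, ℂ))
      (x : Fin N → (twistedPolygonalSphere N 2).Alg) (i j k : Fin N),
      tensorMulVec w x i * tensorMulVec w x j * tensorMulVec w x k =
      ∑ a, ∑ b, ∑ c, MinTensor.tmul (w i a * w j b * w k c) (x a * x b * x c) := by
    intro w x i j k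
    rw [tensorMulVec_mul, tensorMulVec]
    simp only [Finset.sum_mul, Finset.mul_sum, MinTensor.tmul_mul_tmul]
    rw [Finset.sum_comm]
    refine Finset.sum_congr rfl fun a _ => Finset.sum_comm
  have h : ∀ i j k, i ≠ j → i ≠ k → j ≠ k →
      tensorMulVec (fun i j : Fin N => hyperoctahedralCoord i j)
          (twistedPolygonalSphere N 2).gen i *
        tensorMulVec (fun i j : Fin N => hyperoctahedralCoord i j)
          (twistedPolygonalSphere N 2).gen j *
        tensorMulVec (fun i j : Fin N => hyperoctahedralCoord i j)
          (twistedPolygonalSphere N 2).gen k = 0 := by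
    intro i j k hij hik hjk
    rw [h3]
    refine Finset.sum_eq_zero fun a _ => Finset.sum_eq_zero fun b _ =>
      Finset.sum_eq_zero fun c _ => ?_
    rcases eq_or_ne a b with rfl | hab
    · rw [hc.column a i j hij, zero_mul, MinTensor.zero_tmul]
    rcases eq_or_ne b c with rfl | hbc
    · rw [mul_assoc, hc.column b j k hjk, mul_zero, MinTensor.zero_tmul]
    rcases eq_or_ne a c with rfl | hac
    · rw [mul_right_comm, hc.column a i k hik, zero_mul, MinTensor.zero_tmul]
    rw [(isSpherePoint_gen 2).mul_mul_eq_zero hab hac hbc, MinTensor.tmul_zero]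
  simpa [mul_assoc] using h (f 0) (f 1) (f 2) (hf.ne (by decide)) (hf.ne (by decide))
    (hf.ne (by decide))

/-! ### Universality of H_N at d = 2 -/

/-- The relation given by the monomials `x_a² x_b`. -/
theorem ActsAffinely.cubic_relation {w : Fin N → Fin N → A}
    (hw : ActsAffinely w (twistedPolygonalSphere N 2)) {i j k : Fin N} (hij : i ≠ j) (hik : i ≠ k)
    (hjk : j ≠ k) {a b : Fin N} (hab : a ≠ b) :
    w i a * w j a * w k b + w i b * w j a * w k a - w i a * w j b * w k a = 0 := by
  -- The (0, 0) entry of the triple product at a Pauli point; its pure column-b term is zero by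
  -- `h0`, and the others share the factor `36/125 = (3/5)²(4/5)`.
  have h := congrFun (congrFun
    ((hw.isSpherePoint_pauli le_rfl hab).mul_mul_eq_zero hij hik hjk) 0) 0
  have h0 := (hw.isSpherePoint_column (by norm_num) b).mul_mul_eq_zero hij hik hjk
  simp only [Matrix.mul_apply, Fin.sum_univ_two, Matrix.zero_apply] at h
  simp only [Matrix.of_apply, Matrix.cons_val', Matrix.cons_val_zero, Matrix.cons_val_one,
    Matrix.cons_val_fin_one, smul_mul_smul_comm, mul_neg, add_mul, neg_mul, h0, smul_zero,
    zero_add] at h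
  have h2 : (36 / 125 : ℂ) •
      (w i a * w j a * w k b + w i b * w j a * w k a - w i a * w j b * w k a) = 0 := by
    rw [← h]
    simp only [smul_sub, smul_add]
    norm_num
    abel
  exact (smul_eq_zero.1 h2).resolve_left (by norm_num)

/-- A third row k is used to test the product: the cubic identity is linear in column b, so
contracting it with row k isolates `w i a * w j a` by row orthogonality. -/
theorem ActsAffinely.mul_eq_zero {w : Fin N → Fin N → A} (hN : 3 ≤ N)
    (hw : ActsAffinely w (twistedPolygonalSphere N 2)) (hq : IsQuantumGroup w) (a i j : Fin N)
    (hij : i ≠ j) : w i a * w j a = 0 := by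
  obtain ⟨k, hk⟩ : ∃ k, k ∉ ({i, j} : Finset (Fin N)) := by
    by_contra! h
    have h1 := Finset.card_le_card (fun k _ => h k : (Finset.univ : Finset (Fin N)) ⊆ {i, j})
    rw [Finset.card_fin, Finset.card_pair hij] at h1
    omega
  rw [Finset.mem_insert, Finset.mem_singleton, not_or] at hk
  have hik : i ≠ k := Ne.symm hk.1
  have hjk : j ≠ k := Ne.symm hk.2
  have ht := hw.isTwisted le_rfl hq
  have hcol := hw.isSpherePoint_column (by norm_num) a
  -- The cubic identity with the factor from column b moved to the right, past entries in other rows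
  -- and columns. At b = a every term vanishes already, so the identity holds for all b and can be
  -- summed.
  have key : ∀ b, w i a * w j a * w k b + w j a * w k a * w i b - w i a * w k a * w j b = 0 := by
    intro b
    rcases eq_or_ne a b with rfl | hab
    · have h1 : w i a * w j a * w k a = 0 := hcol.mul_mul_eq_zero hij hik hjk
      have h2 : w j a * w k a * w i a = 0 := hcol.mul_mul_eq_zero hjk hij.symm hik.symm
      have h3 : w i a * w k a * w j a = 0 := hcol.mul_mul_eq_zero hik hij hjk.symm
      rw [h1, h2, h3, add_zero, sub_zero]
    · rw [← hw.cubic_relation hij hik hjk hab]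
      have e1 : w j a * w k a * w i b = w i b * w j a * w k a := by
        rw [mul_assoc, ht.comm hik.symm hab, ← mul_assoc, ht.comm hij.symm hab]
      have e2 : w i a * w k a * w j b = w i a * w j b * w k a := by
        rw [mul_assoc, ht.comm hjk.symm hab, ← mul_assoc]
      rw [e1, e2]
  -- In the sum over b, the first term contracts row k with itself and gives `w i a * w j a`; the
  -- other two contract it with rows i and j and give zero.
  have hsum : ∑ b, (w i a * w j a * w k b + w j a * w k a * w i b - w i a * w k a * w j b) *
      w k b = 0 := by simp only [key, zero_mul, Finset.sum_const_zero]
  simpa only [sub_mul, add_mul, mul_assoc, Finset.sum_sub_distrib, Finset.sum_add_distrib,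
    ← Finset.mul_sum, hq.row, if_true, if_neg hik, if_neg hjk, mul_zero, mul_one, add_zero,
    sub_zero] using hsum

theorem isQuantumIsometryGroup_hyperoctahedral (hN : 3 ≤ N) :
    IsQuantumIsometryGroup.{0, v} (fun i j : Fin N => hyperoctahedralCoord i j)
      (twistedPolygonalSphere N 2) where
  isQuantumGroup := isQuantumGroup_hyperoctahedral N
  actsAffinely := actsAffinely_hyperoctahedral N
  universal _ _ _ hq hw :=
    have hc := hq.isCubic (hw.mul_eq_zero hN hq)
    exists_hyperoctahedral_lift hq.isOrthogonal hc (hc.comm (hw.isTwisted le_rfl hq))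

end

end

end QIso

theorem theorem3p5 (N : ℕ) (hN : 1 ≤ N) :
    QIso.IsQuantumIsometryGroup.{0, v}
        (fun i j => (QIso.freeHyperoctahedral N).gen (i, j))
        (QIso.twistedPolygonalSphere N 1) ∧
      (3 ≤ N → QIso.IsQuantumIsometryGroup.{0, v}
        (fun i j : Fin N => QIso.hyperoctahedralCoord i j)
        (QIso.twistedPolygonalSphere N 2)) ∧
      QIso.IsQuantumIsometryGroup.{0, v}
        (fun i j => (QIso.twistedOrthogonal N).gen (i, j))
        (QIso.twistedPolygonalSphere N N) :=
  ⟨QIso.isQuantumIsometryGroup_freeHyperoctahedral N,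
    fun h => QIso.isQuantumIsometryGroup_hyperoctahedral h,
    QIso.isQuantumIsometryGroup_twistedOrthogonal N⟩
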